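/- Let $m,n,d,e,k$ be positive integers with $m=2n$, $e=\gcd(n,d)=\gcd(m,d)$ and $1\le k\le n/e$. Let $s=(s(0),\dots,s(2^m-2))$ be a maximum-length binary sequence of length $2^m-1$, i.e. a nonzero sequence over $\mathbb F_2$, indexed modulo $2^m-1$, that satisfies a linear recurrence of order $m$ over $\mathbb F_2$ and has least period $2^m-1$. For $0\le j<k$ let $s_j$ be the circular decimation of $s$ with factor $2^{(n/e-j)d}+1$, i.e. $s_j(i)=s\big((2^{(n/e-j)d}+1)\,i\big)$ with indices modulo $2^m-1$, and assume that $s_0$ is not the zero sequence. Let $C$ be the $\mathbb F_2$-vector space generated by all circular shifts of $s,s_0,s_1,\dots,s_{k-1}$, and for $c=(c_0,\dots,c_{2^m-2})\in C$ let $\mathrm{DC}(c)=\sum_{i=0}^{2^m-2}(-1)^{c_i}$ be its DC component. Then $$\#\{c\in C : \mathrm{DC}(c)=-1\}=2^{n(2k+1)}-1-\sum_{v=0}^{k-1}(-1)^v\left(2^{n(2k-1-2v)+ev}-1\right)2^{m-ev(v+1)}\prod_{j=0}^{v-1}\left(2^m-4^{ej}\right).$$ Moreover this number is approximately $2^{n(2k+1)}\sum_{v=1}^{k-1}(-1)^{v-1}2^{-ev^2}$,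 in the sense that $$\left|\#\{c\in C : \mathrm{DC}(c)=-1\}-2^{n(2k+1)}\sum_{v=1}^{k-1}(-1)^{v-1}2^{-ev^2}\right|\le 2^{-n}\cdot 2^{n(2k+1)}=2^{2nk}.$$ -/

import Mathlib

/-- Binary sequences of length `N`, with indices read modulo `N` (so that circular operations make
sense); the entries are `c 0, c 1, …, c (N - 1)`. -/
abbrev BinSeq (N : ℕ) := ZMod N → ZMod 2

namespace BinSeq

/-- The circular shift of `c` by `t` places. -/
def shift {N : ℕ} (t : ZMod N) (c : BinSeq N) : BinSeq N := fun i => c (i + t)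

/-- The circular decimation of `c` with decimation factor `f`. -/
def decimate {N : ℕ} (f : ℕ) (c : BinSeq N) : BinSeq N := fun i => c ((f : ZMod N) * i)

/-- `s` is a maximum-length binary sequence of length `2 ^ r - 1`: a nonzero sequence that is produced
by a linear recurrence of order `r` over `𝔽₂` (a linear feedback shift register with `r` cells) and
whose least period is `2 ^ r - 1`. -/
structure IsMaxLength (r : ℕ) (s : BinSeq (2 ^ r - 1)) : Prop where
  ne_zero : s ≠ 0
  recurrence : ∃ E : LinearRecurrence (ZMod 2),
    E.order = r ∧ E.IsSolution (fun i : ℕ => s (i : ZMod (2 ^ r - 1)))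
  period : ∀ t : ZMod (2 ^ r - 1), shift t s = s → t = 0

/-- The DC component `∑_{i=0}^{N-1} (-1)^{c_i}`. -/
def dc {N : ℕ} (c : BinSeq N) : ℤ :=
  ∑ i ∈ Finset.range N, (-1 : ℤ) ^ (c (i : ZMod N)).val

/-- The sequence `s_j`: the circular decimation of `s` with factor `2 ^ ((n / e - j) d) + 1`. -/
def kasamiDecimation {N : ℕ} (n d e : ℕ) (s : BinSeq N) (j : ℕ) : BinSeq N :=
  decimate (2 ^ ((n / e - j) * d) + 1) s

/-- The code `C`: the `𝔽₂`-space generated by all circular shifts of `s, s_0, s_1, …, s_{k-1}`. -/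
def kasamiCode {N : ℕ} (n d e k : ℕ) (s : BinSeq N) : Submodule (ZMod 2) (BinSeq N) :=
  Submodule.span (ZMod 2)
    {c | ∃ t : ZMod N, c = shift t s ∨ ∃ j < k, c = shift t (kasamiDecimation n d e s j)}

end BinSeq

/-!
Write `k = κ + 1`, `N = n / e`, `q = 2 ^ e` and `Q = 2 ^ m`.

*The field.* The nonzero solutions of the recurrence of a maximum-length sequence `s` are exactly the
shifts of `s`. Hence the quotient of `𝔽₂[X]` by the annihilator of `s` is a field `F` with `Q` elements
in which the shift becomes a primitive element `α`, and `s i = Tr (θ α ^ i)`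
(`exists_field_of_isMaxLength`). Let `σ` be the `d`-th power of the Frobenius automorphism and `K` its
fixed field. Then `|K| = q` and `σ` has order `[F : K] = 2 N`; that `gcd (n, d) = gcd (m, d)` makes
`σ ^ N` the involution of `F`.

*The code.* The codewords are the sequences `i ↦ Tr (a x + Q_b x)` at `x = α ^ i`, where
`Q_b x = ∑ b_j x σ^{N-j}(x)` (`range_codeword`). All `b ∈ F ^ (κ + 1)` are admitted; only the
symmetrization `b_0 + σ^N(b_0)` matters, so each codeword is counted `2 ^ n` times. The DC component is
`-1` iff `∑_x (-1)^{Tr (a x + Q_b x)} = 0`. For given `b` this sum is nonzero for `Q / X_b` values of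
`a`, where `X_b` is the size of the radical of the polar form of `Q_b`
(`card_filter_expSum_ne_zero`). So the problem is to compute `∑_b 1 / X_b`.

*The ranks.* The polar form is represented by a `σ`-polynomial with `2 κ + 1` consecutive terms, and a
Moore determinant shows that its kernel has `K`-dimension at most `2 κ` unless it is zero. Polar forms
are alternating, so the dimension is even: `X_b = q ^ (2 i)` with `i ≤ κ`. By the same Moore argument
applied to the dual problem, `r ≤ κ` independent vectors lie in the radical for a proportion of the `b`
that depends only on `r` (`card_filter_polar_eq_zero_mul`). This determines the moments
`∑_b ∏_{j<v} (X_b - q ^ (2 j))` for `v ≤ κ` (`sum_containing_prod_sub`), and Newton interpolation of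
`X⁻¹` at the nodes `q ^ (2 i)` turns the moments into `∑_b 1 / X_b` (`sum_inv_natCard`).
-/

namespace KasamiCode

open Module

/-! ### Alternating forms have even rank -/

/-- The dimension of an alternating space and that of its radical have the same parity: a maximal
totally isotropic subspace `W` is its own orthogonal, so `2 dim W = dim V + dim rad`. -/
theorem even_finrank_add_finrank_orthogonal_top {K V : Type*} [Field K] [AddCommGroup V]
    [Module K V] [FiniteDimensional K V] (B : LinearMap.BilinForm K V) (hB : B.IsAlt) :
    Even (finrank K V + finrank K (B.orthogonal ⊤)) := by
  obtain ⟨W, hWiso, hWmax⟩ := (wellFounded_gt (α := Submodule K V)).has_min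
    {W | W ≤ B.orthogonal W} ⟨⊥, show ⊥ ≤ B.orthogonal ⊥ from bot_le⟩
  have hle : B.orthogonal W ≤ W := by
    intro z hz
    by_contra hzW
    refine hWmax (W ⊔ K ∙ z) ?_ (lt_of_le_of_ne le_sup_left fun h => hzW ?_)
    · intro v hv w hw
      obtain ⟨a, ha, b, hb, rfl⟩ := Submodule.mem_sup.1 hv
      obtain ⟨c, hc, d, hd, rfl⟩ := Submodule.mem_sup.1 hw
      obtain ⟨t, rfl⟩ := Submodule.mem_span_singleton.1 hb
      obtain ⟨u, rfl⟩ := Submodule.mem_span_singleton.1 hd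
      have h1 : B c a = 0 := hWiso ha c hc
      have h2 : B c z = 0 := hz c hc
      have h3 : B z a = 0 := hB.isRefl _ _ (hz a ha)
      have h4 : B z z = 0 := hB z
      simp [h1, h2, h3, h4]
    · rw [h]
      exact Submodule.mem_sup_right (Submodule.mem_span_singleton_self z)
  have heq : B.orthogonal W = W := le_antisymm hle hWiso
  have h := LinearMap.BilinForm.finrank_add_finrank_orthogonal hB.isRefl W
  rw [heq, inf_eq_right.2] at h
  · exact ⟨_, h.symm⟩
  · rw [← heq]
    exact LinearMap.BilinForm.orthogonal_le le_top

/-! ### Moore systems -/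

section Moore

variable {K F : Type*} [Field K] [Field F] [Algebra K F] {σ : F ≃ₐ[K] F}

/-- The Moore matrix of linearly independent elements has trivial kernel. Normalising one
coefficient and subtracting `σ` of an equation from the next one shortens a relation, unless all the
coefficients are fixed by `σ`. -/
theorem eq_zero_of_sum_mul_pow_apply (hfix : ∀ x, σ x = x → ∃ c : K, algebraMap K F c = x)
    {p : ℕ} (l : ℕ) {z : Fin p → F} (hz : LinearIndependent K z) {γ : Fin p → F}
    (h : ∀ i < p, ∑ t, γ t * (σ ^ (l + i)) (z t) = 0) : γ = 0 := by
  induction p generalizing l with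
  | zero => exact Subsingleton.elim _ _
  | succ p ih =>
    have hz' : LinearIndependent K (fun t : Fin p => z t.succ) :=
      hz.comp _ (Fin.succ_injective p)
    by_cases h0 : γ 0 = 0
    · have := ih l hz' (γ := fun t => γ t.succ) fun i hi => by
        simpa [Fin.sum_univ_succ, h0] using h i (by omega)
      funext t
      refine Fin.cases h0 (fun t => congrFun this t) t
    · exfalso
      have hd : ∀ i < p + 1, ∑ t, (γ t / γ 0) * (σ ^ (l + i)) (z t) = 0 := fun i hi => by
        have : ∑ t, (γ t / γ 0) * (σ ^ (l + i)) (z t)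
            = (γ 0)⁻¹ * ∑ t, γ t * (σ ^ (l + i)) (z t) := by
          rw [Finset.mul_sum]
          exact Finset.sum_congr rfl fun t _ => by ring
        rw [this, h i hi, mul_zero]
      have hs := ih (l + 1) hz' (γ := fun t => σ (γ t.succ / γ 0) - γ t.succ / γ 0) fun i hi => by
        have e1 := congrArg σ (hd i (by omega))
        have e2 := hd (i + 1) (by omega)
        rw [map_sum, map_zero] at e1
        have key : ∑ t, (σ (γ t / γ 0) - γ t / γ 0) * (σ ^ (l + 1 + i)) (z t) = 0 := by
          rw [← sub_zero (0 : F)]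
          nth_rewrite 1 [← e1]
          rw [← e2, ← Finset.sum_sub_distrib]
          refine Finset.sum_congr rfl fun t _ => ?_
          rw [map_mul, sub_mul, ← AlgEquiv.mul_apply, ← pow_succ',
            show l + i + 1 = l + 1 + i by ring, show l + (i + 1) = l + 1 + i by ring]
        rw [Fin.sum_univ_succ] at key
        simpa [div_self h0] using key
      have hf : ∀ t, ∃ c : K, algebraMap K F c = γ t / γ 0 := fun t => by
        refine hfix _ ?_
        refine Fin.cases (by simp [div_self h0]) (fun t => ?_) t
        exact sub_eq_zero.1 (congrFun hs t)
      choose c hc using hf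
      have e0 : (σ ^ l) (∑ t, c t • z t) = 0 := by
        rw [map_sum]
        have := hd 0 (by omega)
        rw [← this]
        refine Finset.sum_congr rfl fun t _ => ?_
        rw [map_smul, Algebra.smul_def, hc, add_zero]
      have e1 : ∑ t, c t • z t = 0 := (map_eq_zero_iff _ (σ ^ l).injective).1 e0
      have e2 := Fintype.linearIndependent_iff.1 hz c e1 0
      have e3 := hc 0
      rw [e2, map_zero, div_self h0] at e3
      exact zero_ne_one e3

/-- The vanishing of `∑ γ_t σ^l(z_t)` for as many consecutive `l` as there are terms forces
`∑ γ_t ⊗ z_t = 0`; this is expressed by means of linear functionals on the second factor. -/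
theorem sum_smul_eq_zero_of_sum_mul_pow_apply
    (hfix : ∀ x, σ x = x → ∃ c : K, algebraMap K F c = x)
    {ι : Type*} [Fintype ι] {p : ℕ} (hp : Fintype.card ι ≤ p) (l : ℕ) {z γ : ι → F}
    (h : ∀ i < p, ∑ t, γ t * (σ ^ (l + i)) (z t) = 0) (φ : F →ₗ[K] K) :
    ∑ t, φ (z t) • γ t = 0 := by
  let W := Submodule.span K (Set.range z)
  have : FiniteDimensional K W := FiniteDimensional.span_of_finite K (Set.finite_range z)
  let w := Module.finBasis K W
  have hW : finrank K W ≤ p := (finrank_range_le_card z).trans hp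
  let z' : ι → W := fun t => ⟨z t, Submodule.subset_span ⟨t, rfl⟩⟩
  have hz : ∀ t, z t = ∑ s, w.repr (z' t) s • (w s : F) := fun t => by
    have := congrArg W.subtype (w.sum_repr (z' t))
    rw [map_sum] at this
    exact this.symm
  have hli : LinearIndependent K (fun s => (w s : F)) :=
    w.linearIndependent.map' W.subtype (Submodule.ker_subtype W)
  have hc := eq_zero_of_sum_mul_pow_apply hfix l hli
    (γ := fun s => ∑ t, w.repr (z' t) s • γ t) fun i hi => by
      rw [← h i (hi.trans_le hW)]
      simp_rw [Finset.sum_mul]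
      rw [Finset.sum_comm]
      refine Finset.sum_congr rfl fun t _ => ?_
      conv_rhs => rw [hz t, map_sum, Finset.mul_sum]
      refine Finset.sum_congr rfl fun s _ => ?_
      rw [map_smul, smul_mul_assoc, mul_smul_comm]
  have : ∑ t, φ (z t) • γ t = ∑ s, φ (w s : F) • ∑ t, w.repr (z' t) s • γ t := by
    simp_rw [Finset.smul_sum]
    rw [Finset.sum_comm]
    refine Finset.sum_congr rfl fun t _ => ?_
    conv_lhs => rw [hz t, map_sum, Finset.sum_smul]
    refine Finset.sum_congr rfl fun s _ => ?_
    rw [map_smul, smul_smul, smul_eq_mul, mul_comm]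
  rw [this]
  exact Finset.sum_eq_zero fun s _ => by rw [show ∑ t, w.repr (z' t) s • γ t = 0 from congrFun hc s,
    smul_zero]

/-- A nonzero `σ`-polynomial with `p` consecutive terms has fewer than `p` independent roots. -/
theorem eq_zero_of_sum_mul_pow_apply_of_le_finrank
    (hfix : ∀ x, σ x = x → ∃ c : K, algebraMap K F c = x) [FiniteDimensional K F]
    {p : ℕ} (l : ℕ) (U : Submodule K F) (hU : p ≤ finrank K U) {c : Fin p → F}
    (h : ∀ x ∈ U, ∑ i, c i * (σ ^ (l + i)) x = 0) : c = 0 := by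
  let w := Module.finBasis K U
  let z : Fin p → F := fun t => (w (Fin.castLE hU t) : F)
  have hz : LinearIndependent K z :=
    (w.linearIndependent.map' U.subtype (Submodule.ker_subtype U)).comp _
      (Fin.castLE_injective hU)
  let M : Matrix (Fin p) (Fin p) F := Matrix.of fun i t => (σ ^ (l + i : ℕ)) (z t)
  have hdet : M.det ≠ 0 := fun hdet => by
    obtain ⟨γ, hγ, hM⟩ := Matrix.exists_mulVec_eq_zero_iff.2 hdet
    refine hγ (eq_zero_of_sum_mul_pow_apply hfix l hz fun i hi => ?_)
    have := congrFun hM ⟨i, hi⟩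
    simp only [Matrix.mulVec, dotProduct, M, Matrix.of_apply, Pi.zero_apply] at this
    rw [← this]
    exact Finset.sum_congr rfl fun t _ => mul_comm _ _
  by_contra hc
  refine hdet (Matrix.exists_vecMul_eq_zero_iff.1 ⟨c, hc, ?_⟩)
  funext t
  exact h _ (w (Fin.castLE hU t)).2

end Moore

/-! ### The quadratic forms of the code and their polar forms -/

section Forms

variable {K F : Type*} [Field K] [Field F] [Algebra K F] (σ : F ≃ₐ[K] F) (N : ℕ) {κ : ℕ}

/-- The quadratic map `x ↦ ∑_j b_j x σ^{N-j}(x)`; composed with a trace it is the quadratic form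
belonging to the coefficients `b`. -/
def quad (b : Fin (κ + 1) → F) (x : F) : F :=
  ∑ j, b j * (x * (σ ^ (N - j)) x)

/-- The operator that represents the polar form of `quad σ N b` with respect to a `σ`-invariant
trace form. As `σ ^ (2 * N) = 1` in the application, `σ ^ (N + j)` is the inverse of
`σ ^ (N - j)`. -/
def polar (b : Fin (κ + 1) → F) : F →ₗ[K] F :=
  ∑ j, ((LinearMap.mulLeft K (b j)) ∘ₗ (σ ^ (N - j : ℕ)).toLinearMap +
    (σ ^ (N + j : ℕ)).toLinearMap ∘ₗ (LinearMap.mulLeft K (b j)))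

theorem polar_apply (b : Fin (κ + 1) → F) (x : F) :
    polar σ N b x = ∑ j, (b j * (σ ^ (N - j : ℕ)) x + (σ ^ (N + j : ℕ)) (b j * x)) := by
  simp [polar, LinearMap.sum_apply]

variable {σ N}

theorem pow_sub_pow_add_apply (hσ : σ ^ (2 * N) = 1) {j : ℕ} (hj : j ≤ N) (x : F) :
    (σ ^ (N - j)) ((σ ^ (N + j)) x) = x := by
  rw [← AlgEquiv.mul_apply, ← pow_add, show N - j + (N + j) = 2 * N by omega, hσ,
    AlgEquiv.one_apply]

theorem pow_add_pow_sub_apply (hσ : σ ^ (2 * N) = 1) {j : ℕ} (hj : j ≤ N) (x : F) :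
    (σ ^ (N + j)) ((σ ^ (N - j)) x) = x := by
  rw [← AlgEquiv.mul_apply, ← pow_add, show N + j + (N - j) = 2 * N by omega, hσ,
    AlgEquiv.one_apply]

/-- The operator `polar σ N b` as a `σ`-polynomial with `2κ + 1` consecutive terms. -/
theorem polar_apply_eq_sum_append (hκ : κ ≤ N) (b : Fin (κ + 1) → F) (x : F) :
    polar σ N b x = ∑ i : Fin (κ + 1 + κ), Fin.append (Fin.append (fun i : Fin κ => b i.rev.succ)
      (fun _ : Fin 1 => b 0 + (σ ^ N) (b 0)))
      (fun i : Fin κ => (σ ^ (N + (i + 1) : ℕ)) (b i.succ)) i * (σ ^ (N - κ + i : ℕ)) x := by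
  rw [polar_apply, Fin.sum_univ_succ, Fin.sum_univ_add, Fin.sum_univ_add]
  simp only [Fin.append_left, Fin.append_right, Fin.val_castAdd, Fin.val_natAdd,
    Finset.univ_unique, Finset.sum_singleton, Finset.sum_add_distrib, Fin.val_succ]
  rw [← Equiv.sum_comp Fin.revPerm (fun i : Fin κ => b i.succ * (σ ^ (N - (i + 1) : ℕ)) x)]
  have h1 : ∀ i : Fin κ, N - ((i.rev : ℕ) + 1) = N - κ + i := fun i => by
    rw [Fin.val_rev]; omega
  have h2 : ∀ i : Fin κ, N - κ + (κ + 1 + i) = N + (i + 1) := fun i => by omega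
  have h3 : N - κ + (κ + (default : Fin 1)) = N := by simp; omega
  simp only [Fin.revPerm_apply, h1, h2, h3, map_mul, Fin.val_zero, Nat.sub_zero, add_zero]
  ring

/-- If the radical of a form has dimension more than `2κ`, all coefficients of its `σ`-polynomial vanish. -/
theorem coeff_eq_of_lt_finrank_ker (hfix : ∀ x, σ x = x → ∃ c : K, algebraMap K F c = x)
    [FiniteDimensional K F] (hκ : κ ≤ N) {b : Fin (κ + 1) → F}
    (h : 2 * κ < finrank K (LinearMap.ker (polar σ N b))) :
    b 0 + (σ ^ N) (b 0) = 0 ∧ ∀ j : Fin κ, b j.succ = 0 := by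
  have hc := eq_zero_of_sum_mul_pow_apply_of_le_finrank (p := κ + 1 + κ) hfix (N - κ)
    (LinearMap.ker (polar σ N b)) (by omega)
    (fun x hx => by
      rw [← polar_apply_eq_sum_append hκ b x]
      exact hx)
  constructor
  · have := congrFun hc (Fin.castAdd κ (Fin.natAdd κ 0))
    rw [Fin.append_left, Fin.append_right] at this
    exact this
  · intro j
    have := congrFun hc (Fin.natAdd (κ + 1) j)
    rw [Fin.append_right] at this
    exact (map_eq_zero_iff _ (σ ^ (N + (j + 1) : ℕ)).injective).1 this

theorem polar_eq_zero_iff (hfix : ∀ x, σ x = x → ∃ c : K, algebraMap K F c = x)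
    [FiniteDimensional K F] (hN : finrank K F = 2 * N) (hκ : κ < N) {b : Fin (κ + 1) → F} :
    polar σ N b = 0 ↔ b 0 + (σ ^ N) (b 0) = 0 ∧ ∀ j : Fin κ, b j.succ = 0 := by
  constructor
  · intro h
    refine coeff_eq_of_lt_finrank_ker hfix hκ.le ?_
    rw [h, LinearMap.ker_zero, finrank_top]
    omega
  · rintro ⟨h0, h1⟩
    ext x
    rw [polar_apply, Fin.sum_univ_succ]
    simp only [h1, zero_mul, map_zero, add_zero, Finset.sum_const_zero, Fin.val_zero, Nat.sub_zero,
      map_mul, LinearMap.zero_apply]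
    rw [← add_mul, h0, zero_mul]

/-- The radical of each form has even dimension. -/
theorem even_finrank_ker_polar [CharP F 2] [FiniteDimensional K F] [Algebra.IsSeparable K F]
    (hσ : σ ^ (2 * N) = 1) (hN : finrank K F = 2 * N) (hκ : κ ≤ N) (b : Fin (κ + 1) → F) :
    Even (finrank K (LinearMap.ker (polar σ N b))) := by
  have : CharP K 2 := (algebraMap K F).charP (algebraMap K F).injective 2
  let B : LinearMap.BilinForm K F := (Algebra.traceForm K F).comp LinearMap.id (polar σ N b)
  have hB : ∀ x y, B x y = Algebra.trace K F (x * polar σ N b y) := fun x y => rfl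
  have halt : B.IsAlt := fun x => by
    rw [hB, polar_apply, Finset.mul_sum, map_sum]
    refine Finset.sum_eq_zero fun j _ => ?_
    have e := Algebra.trace_eq_of_algEquiv (σ ^ (N - j : ℕ)) (x * (σ ^ (N + j : ℕ)) (b j * x))
    rw [map_mul, pow_sub_pow_add_apply hσ (by omega)] at e
    rw [mul_add, map_add, ← e, mul_comm ((σ ^ (N - j : ℕ)) x), ← mul_assoc, mul_comm x,
      mul_right_comm, CharTwo.add_self_eq_zero]
  have hker : B.orthogonal ⊤ = LinearMap.ker (polar σ N b) := by
    ext y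
    constructor
    · intro hy
      refine LinearMap.mem_ker.2 ((traceForm_nondegenerate K F).2 _ fun x => ?_)
      exact hy x trivial
    · intro hy x _
      change B x y = 0
      rw [hB, LinearMap.mem_ker.1 hy, mul_zero, map_zero]
  have h := even_finrank_add_finrank_orthogonal_top B halt
  rw [hker, hN] at h
  exact (Nat.even_add.1 h).1 (even_two_mul N)

end Forms

/-! ### Vanishing of the polar forms on independent vectors -/

section Design

variable {K F : Type*} [Field K] [Field F] [Algebra K F] {σ : F ≃ₐ[K] F} {N κ : ℕ}

/-- The relation `∑ u_i ∧ y_i = 0`, tested through `κ + 1` of the forms `x ∧ y ↦ x σ^l(y) + y σ^l(x)`,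
holds only when `y` arises from `u` by a symmetric matrix. -/
theorem exists_isSymm_of_sum_eq_zero [CharP F 2] [FiniteDimensional K F]
    (hfix : ∀ x, σ x = x → ∃ c : K, algebraMap K F c = x) (hσ : σ ^ (2 * N) = 1) (hκ : κ ≤ N)
    {r : ℕ} (hr : r ≤ κ) {u y : Fin r → F} (hu : LinearIndependent K u)
    (h : ∀ j ≤ κ, ∑ i, (y i * (σ ^ (N - j)) (u i) + u i * (σ ^ (N - j)) (y i)) = 0) :
    ∃ a : Matrix (Fin r) (Fin r) K, a.IsSymm ∧ ∀ i, y i = ∑ l, a i l • u l := by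
  have h2 : ∀ i < 2 * κ + 1, ∑ t : Fin r ⊕ Fin r,
      Sum.elim y u t * (σ ^ (N - κ + i)) (Sum.elim u y t) = 0 := by
    intro i hi
    simp only [Fintype.sum_sum_type, Sum.elim_inl, Sum.elim_inr]
    rw [← Finset.sum_add_distrib]
    by_cases hiκ : i ≤ κ
    · rw [show N - κ + i = N - (κ - i) by omega]
      exact h _ (by omega)
    · obtain ⟨j, rfl⟩ : ∃ j, i = κ + j := ⟨i - κ, by omega⟩
      have e := congrArg (σ ^ (N + j)) (h j (by omega))
      rw [map_sum, map_zero] at e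
      rw [← e, show N - κ + (κ + j) = N + j by omega]
      refine Finset.sum_congr rfl fun t _ => ?_
      rw [map_add, map_mul, map_mul, pow_add_pow_sub_apply hσ (by omega),
        pow_add_pow_sub_apply hσ (by omega)]
      ring
  have hφ := sum_smul_eq_zero_of_sum_mul_pow_apply hfix
    (by simp only [Fintype.card_sum, Fintype.card_fin]; omega) (N - κ) h2
  simp only [Fintype.sum_sum_type, Sum.elim_inl, Sum.elim_inr] at hφ
  -- functionals dual to the independent family `u`
  obtain ⟨φ, hφu⟩ : ∃ φ : Fin r → (F →ₗ[K] K), ∀ i l, φ i (u l) = if i = l then 1 else 0 := by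
    have : ∀ i, ∃ f : F →ₗ[K] K, ∀ l, f (u l) = if i = l then 1 else 0 := fun i => by
      obtain ⟨f, hf⟩ := LinearMap.exists_extend
        ((Finsupp.lapply i : (Fin r →₀ K) →ₗ[K] K) ∘ₗ hu.repr)
      refine ⟨f, fun l => ?_⟩
      have := LinearMap.congr_fun hf ⟨u l, Submodule.subset_span ⟨l, rfl⟩⟩
      rw [LinearMap.comp_apply] at this
      refine this.trans ?_
      rw [LinearMap.comp_apply,
        hu.repr_eq_single l ⟨u l, Submodule.subset_span ⟨l, rfl⟩⟩ rfl, Finsupp.lapply_apply,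
        Finsupp.single_apply]
      exact if_congr eq_comm rfl rfl
    choose φ hφ using this
    exact ⟨φ, hφ⟩
  have hy : ∀ i, y i = ∑ l, φ i (y l) • u l := fun i => by
    have := hφ (φ i)
    simp only [hφu, ite_smul, one_smul, zero_smul, Finset.sum_ite_eq, Finset.mem_univ,
      if_true] at this
    exact CharTwo.add_eq_zero.1 this
  refine ⟨fun i l => φ i (y l), ?_, hy⟩
  ext i l
  change φ l (y i) = φ i (y l)
  conv_lhs => rw [hy i]
  simp [hφu]

/-- The converse of `exists_isSymm_of_sum_eq_zero`. -/
theorem sum_eq_zero_of_isSymm [CharP F 2] {r : ℕ} {u : Fin r → F} {a : Matrix (Fin r) (Fin r) K}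
    (ha : a.IsSymm) (τ : F ≃ₐ[K] F) :
    ∑ i, ((∑ l, a i l • u l) * τ (u i) + u i * τ (∑ l, a i l • u l)) = 0 := by
  have e1 : ∑ i, (∑ l, a i l • u l) * τ (u i) = ∑ i, u i * τ (∑ l, a i l • u l) := by
    simp only [map_sum, Finset.sum_mul, Finset.mul_sum, map_smul]
    rw [Finset.sum_comm]
    refine Finset.sum_congr rfl fun i _ => Finset.sum_congr rfl fun l _ => ?_
    rw [ha.apply, smul_mul_assoc, mul_smul_comm]
  rw [Finset.sum_add_distrib, e1, CharTwo.add_self_eq_zero]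

theorem card_isSymm (K : Type*) [Fintype K] [Zero K] (r : ℕ) :
    Nat.card {a : Matrix (Fin r) (Fin r) K // a.IsSymm}
      = Fintype.card K ^ ((r + 1).choose 2) := by
  have e : {a : Matrix (Fin r) (Fin r) K // a.IsSymm} ≃ (Sym2 (Fin r) → K) :=
    (Equiv.subtypeEquivRight fun a => by
      rw [Matrix.IsSymm.ext_iff]
      exact ⟨fun h i l => h l i, fun h i l => h l i⟩).trans Sym2.lift
  rw [Nat.card_congr e, Nat.card_eq_fintype_card, Fintype.card_fun, Sym2.card, Fintype.card_fin]

theorem card_setOf_sum_eq_zero [Fintype K] [CharP F 2] [FiniteDimensional K F]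
    (hfix : ∀ x, σ x = x → ∃ c : K, algebraMap K F c = x) (hσ : σ ^ (2 * N) = 1) (hκ : κ ≤ N)
    {r : ℕ} (hr : r ≤ κ) {u : Fin r → F} (hu : LinearIndependent K u) :
    Nat.card {y : Fin r → F //
        ∀ j ≤ κ, ∑ i, (y i * (σ ^ (N - j)) (u i) + u i * (σ ^ (N - j)) (y i)) = 0}
      = Fintype.card K ^ ((r + 1).choose 2) := by
  rw [← card_isSymm K r]
  symm
  refine Nat.card_congr (Equiv.ofBijective
    (fun a => ⟨fun i => ∑ l, a.1 i l • u l, fun j _ => sum_eq_zero_of_isSymm a.2 _⟩) ⟨?_, ?_⟩)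
  · intro a a' h
    have h' := fun i => congrFun (congrArg Subtype.val h) i
    ext i l
    refine sub_eq_zero.1 (Fintype.linearIndependent_iff.1 hu (fun l => a.1 i l - a'.1 i l) ?_ l)
    simp only [sub_smul, Finset.sum_sub_distrib]
    exact sub_eq_zero.2 (h' i)
  · rintro ⟨y, hy⟩
    obtain ⟨a, ha, hay⟩ := exists_isSymm_of_sum_eq_zero hfix hσ hκ hr hu hy
    exact ⟨⟨a, ha⟩, Subtype.ext (funext fun i => (hay i).symm)⟩

end Design

/-! ### Character sums -/

section CharacterSums

variable {K F : Type*} [Field K] [Field F] [Algebra K F]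
  {σ : F ≃ₐ[K] F} {N κ : ℕ} {χ : AddChar F ℚ}

theorem addChar_sum {A ι : Type*} [AddCommMonoid A] (ψ : AddChar A ℚ) (s : Finset ι) (f : ι → A) :
    ψ (∑ i ∈ s, f i) = ∏ i ∈ s, ψ (f i) := by
  classical
  induction s using Finset.induction_on with
  | empty => simp
  | insert i s hi ih => rw [Finset.sum_insert hi, Finset.prod_insert hi, AddChar.map_add_eq_mul, ih]

theorem sum_addChar_mul {F : Type*} [Field F] [Fintype F] [DecidableEq F] {χ : AddChar F ℚ}
    (hχ : χ.IsPrimitive) (c : F) :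
    ∑ x, χ (x * c) = if c = 0 then (Fintype.card F : ℚ) else 0 := by
  rw [AddChar.sum_mulShift c hχ]
  split_ifs <;> simp

theorem addChar_mul_self {F : Type*} [Field F] [CharP F 2] (χ : AddChar F ℚ) (x : F) : χ x * χ x = 1 := by
  rw [← AddChar.map_add_eq_mul, CharTwo.add_self_eq_zero, AddChar.map_zero_eq_one]

theorem addChar_pow_apply {K F : Type*} [Field K] [Field F] [Algebra K F] {σ : F ≃ₐ[K] F}
    {χ : AddChar F ℚ} (hinv : ∀ x, χ (σ x) = χ x) (l : ℕ) (x : F) :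
    χ ((σ ^ l) x) = χ x := by
  induction l with
  | zero => rfl
  | succ l ih => rw [pow_succ', AlgEquiv.mul_apply, hinv, ih]

theorem sum_addChar_sum_mul {F : Type*} [Field F] [Fintype F] [DecidableEq F] {χ : AddChar F ℚ}
    (hχ : χ.IsPrimitive) {ι : Type*} [Fintype ι]
    [DecidableEq ι] (w : ι → F) :
    ∑ v : ι → F, χ (∑ i, v i * w i)
      = if w = 0 then (Fintype.card F : ℚ) ^ Fintype.card ι else 0 := by
  have : ∑ v : ι → F, χ (∑ i, v i * w i) = ∏ i, ∑ x, χ (x * w i) := by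
    rw [Finset.prod_univ_sum, Fintype.piFinset_univ]
    exact Finset.sum_congr rfl fun v _ => addChar_sum _ _ _
  rw [this]
  simp_rw [sum_addChar_mul hχ]
  split_ifs with hw
  · subst hw
    simp
  · obtain ⟨i, hi⟩ := Function.ne_iff.1 hw
    exact Finset.prod_eq_zero (Finset.mem_univ i) (by simpa using hi)

theorem addChar_mul_polar (hσ : σ ^ (2 * N) = 1) (hκ : κ ≤ N) (hinv : ∀ x, χ (σ x) = χ x)
    (b : Fin (κ + 1) → F) (x y : F) :
    χ (y * polar σ N b x)
      = χ (∑ j, b j * (y * (σ ^ (N - j : ℕ)) x + x * (σ ^ (N - j : ℕ)) y)) := by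
  rw [polar_apply, Finset.mul_sum, addChar_sum, addChar_sum]
  refine Finset.prod_congr rfl fun j _ => ?_
  rw [mul_add, mul_add, AddChar.map_add_eq_mul, AddChar.map_add_eq_mul,
    ← addChar_pow_apply hinv (N - j) (y * (σ ^ (N + j : ℕ)) (b j * x)),
    map_mul (σ ^ (N - j : ℕ)),
    pow_sub_pow_add_apply hσ (by omega)]
  congr 2 <;> ring

/-- `polar σ N b` represents the polar form of `quad σ N b`. -/
theorem addChar_quad_add (hσ : σ ^ (2 * N) = 1) (hκ : κ ≤ N) (hinv : ∀ x, χ (σ x) = χ x)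
    (b : Fin (κ + 1) → F) (x y : F) :
    χ (quad σ N b (x + y))
      = χ (quad σ N b x) * χ (quad σ N b y) * χ (y * polar σ N b x) := by
  rw [addChar_mul_polar hσ hκ hinv, ← AddChar.map_add_eq_mul, ← AddChar.map_add_eq_mul]
  congr 1
  simp only [quad]
  rw [← Finset.sum_add_distrib, ← Finset.sum_add_distrib]
  refine Finset.sum_congr rfl fun j _ => ?_
  rw [map_add]
  ring

variable [Fintype F]

open scoped Classical in
/-- The design property: `r ≤ κ` independent vectors lie in the radical for the proportion
`q^{r(r+1)/2} / |F|^r` of all coefficient vectors `b`. -/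
theorem card_filter_polar_eq_zero_mul [Fintype K] [CharP F 2]
    (hfix : ∀ x, σ x = x → ∃ c : K, algebraMap K F c = x) (hσ : σ ^ (2 * N) = 1) (hκ : κ ≤ N)
    (hχ : χ.IsPrimitive) (hinv : ∀ x, χ (σ x) = χ x)
    {r : ℕ} (hr : r ≤ κ) {u : Fin r → F} (hu : LinearIndependent K u) :
    ((Finset.univ.filter fun b : Fin (κ + 1) → F => ∀ i, polar σ N b (u i) = 0).card : ℚ)
        * (Fintype.card F : ℚ) ^ r
      = (Fintype.card F : ℚ) ^ (κ + 1) * (Fintype.card K : ℚ) ^ ((r + 1).choose 2) := by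
  have h1 : ∑ b : Fin (κ + 1) → F, ∑ y : Fin r → F, χ (∑ i, y i * polar σ N b (u i))
      = ((Finset.univ.filter fun b : Fin (κ + 1) → F => ∀ i, polar σ N b (u i) = 0).card : ℚ)
        * (Fintype.card F : ℚ) ^ r := by
    simp_rw [sum_addChar_sum_mul hχ, funext_iff, Pi.zero_apply, Fintype.card_fin]
    rw [← Finset.sum_filter, Finset.sum_const, nsmul_eq_mul]
  have h2 : ∀ (y : Fin r → F) (b : Fin (κ + 1) → F), χ (∑ i, y i * polar σ N b (u i))
      = χ (∑ j, b j * ∑ i, (y i * (σ ^ (N - j : ℕ)) (u i) + u i * (σ ^ (N - j : ℕ)) (y i))) := by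
    intro y b
    simp_rw [Finset.mul_sum]
    rw [Finset.sum_comm, addChar_sum, addChar_sum]
    exact Finset.prod_congr rfl fun i _ => addChar_mul_polar hσ hκ hinv b _ _
  have h3 : Fintype.card {y : Fin r → F //
      ∀ j ≤ κ, ∑ i, (y i * (σ ^ (N - j)) (u i) + u i * (σ ^ (N - j)) (y i)) = 0}
      = Fintype.card K ^ ((r + 1).choose 2) := by
    rw [← card_setOf_sum_eq_zero hfix hσ hκ hr hu, Nat.card_eq_fintype_card]
  rw [← h1, Finset.sum_comm]
  simp_rw [h2, sum_addChar_sum_mul hχ, funext_iff, Pi.zero_apply, Fintype.card_fin]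
  rw [← Finset.sum_filter, Finset.sum_const, nsmul_eq_mul, mul_comm, ← Nat.cast_pow (Fintype.card K),
    ← h3, Fintype.card_subtype]
  congr 3
  ext y
  simp only [Finset.mem_filter, Finset.mem_univ, true_and]
  exact ⟨fun h j hj => h ⟨j, by omega⟩, fun h j => h j (by omega)⟩

/-- The exponential sum of `quad σ N b` twisted by the linear form of `a`. -/
noncomputable def expSum (χ : AddChar F ℚ) (σ : F ≃ₐ[K] F) (N : ℕ) (a : F) (b : Fin (κ + 1) → F) :
    ℚ :=
  ∑ x, χ (a * x + quad σ N b x)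

open scoped Classical in
/-- Substituting `y = x + z` in the square of the sum and summing over `x` first leaves `|F|` times the
sum over the radical of an additive character. -/
theorem expSum_sq [CharP F 2] (hσ : σ ^ (2 * N) = 1) (hκ : κ ≤ N)
    (hχ : χ.IsPrimitive) (hinv : ∀ x, χ (σ x) = χ x) (a : F) (b : Fin (κ + 1) → F) :
    expSum χ σ N a b ^ 2 = 0 ∨ expSum χ σ N a b ^ 2
      = Fintype.card F * Nat.card (LinearMap.ker (polar σ N b)) := by
  -- on the radical the form is additive
  let ψ : AddChar (LinearMap.ker (polar σ N b)) ℚ :=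
    { toFun := fun z => χ (a * z + quad σ N b z)
      map_zero_eq_one' := by simp [quad]
      map_add_eq_mul' := fun x y => by
        have hx : polar σ N b x = 0 := x.2
        rw [Submodule.coe_add, AddChar.map_add_eq_mul, addChar_quad_add hσ hκ hinv, hx, mul_zero,
          AddChar.map_zero_eq_one, mul_add, AddChar.map_add_eq_mul, AddChar.map_add_eq_mul,
          AddChar.map_add_eq_mul]
        ring }
  have h : expSum χ σ N a b ^ 2 = Fintype.card F * ∑ z, ψ z := by
    have h1 : expSum χ σ N a b ^ 2 = ∑ z, χ (a * z + quad σ N b z)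
        * ∑ x, χ (x * polar σ N b z) := by
      rw [sq, expSum, Finset.sum_mul_sum]
      simp_rw [Finset.mul_sum]
      rw [Finset.sum_comm]
      conv_lhs =>
        enter [2, x]
        rw [← Equiv.sum_comp (Equiv.addRight x)]
      rw [Finset.sum_comm]
      refine Finset.sum_congr rfl fun z _ => Finset.sum_congr rfl fun x _ => ?_
      simp only [Equiv.coe_addRight, AddChar.map_add_eq_mul, mul_add,
        addChar_quad_add hσ hκ hinv]
      have e1 := addChar_mul_self χ (a * x)
      have e2 := addChar_mul_self χ (quad σ N b x)
      linear_combination (χ (a * z) * χ (quad σ N b z) * χ (x * polar σ N b z)) *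
        (e1 * (χ (quad σ N b x) * χ (quad σ N b x)) + e2)
    rw [h1]
    simp_rw [sum_addChar_mul hχ]
    simp only [mul_ite, mul_zero]
    rw [← Finset.sum_filter, ← Finset.sum_mul, mul_comm]
    congr 1
    exact Finset.sum_subtype _ (fun z => by simp) _
  rw [h, AddChar.sum_eq_ite, Nat.card_eq_fintype_card]
  split_ifs
  · exact Or.inr rfl
  · exact Or.inl (mul_zero _)

theorem sum_expSum_sq [CharP F 2] (hχ : χ.IsPrimitive) (b : Fin (κ + 1) → F) :
    ∑ a, expSum χ σ N a b ^ 2 = (Fintype.card F : ℚ) ^ 2 := by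
  classical
  have h : ∀ a, expSum χ σ N a b ^ 2 = ∑ x, ∑ y, χ (quad σ N b x) * χ (quad σ N b y)
      * χ (a * (x + y)) := fun a => by
    rw [sq, expSum, Finset.sum_mul_sum]
    refine Finset.sum_congr rfl fun x _ => Finset.sum_congr rfl fun y _ => ?_
    rw [mul_add, AddChar.map_add_eq_mul, AddChar.map_add_eq_mul, AddChar.map_add_eq_mul]
    ring
  simp_rw [h]
  rw [Finset.sum_comm]
  have h2 : ∀ x, ∑ a, ∑ y, χ (quad σ N b x) * χ (quad σ N b y) * χ (a * (x + y))
      = Fintype.card F := fun x => by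
    rw [Finset.sum_comm]
    simp_rw [← Finset.mul_sum, sum_addChar_mul hχ, CharTwo.add_eq_zero, mul_ite, mul_zero]
    rw [Finset.sum_ite_eq, if_pos (Finset.mem_univ x), addChar_mul_self, one_mul]
  simp_rw [h2]
  rw [Finset.sum_const, nsmul_eq_mul, Finset.card_univ, sq]

open scoped Classical in
/-- For fixed `b` the exponential sum is nonzero for `|F| / |rad|` values of `a`: its square is `0` or
`|F| |rad|`, and Parseval's identity gives the sum of the squares. -/
theorem card_filter_expSum_ne_zero [CharP F 2] (hσ : σ ^ (2 * N) = 1) (hκ : κ ≤ N)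
    (hχ : χ.IsPrimitive) (hinv : ∀ x, χ (σ x) = χ x) (b : Fin (κ + 1) → F) :
    ((Finset.univ.filter fun a => expSum χ σ N a b ≠ 0).card : ℚ)
      = Fintype.card F / Nat.card (LinearMap.ker (polar σ N b)) := by
  have h := sum_expSum_sq (σ := σ) (N := N) hχ b
  have h2 : ∀ a, expSum χ σ N a b ^ 2 = if expSum χ σ N a b ≠ 0 then
      (Fintype.card F * Nat.card (LinearMap.ker (polar σ N b)) : ℚ) else 0 := fun a => by
    split_ifs with h0
    · exact (expSum_sq hσ hκ hχ hinv a b).resolve_left (pow_ne_zero 2 h0)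
    · rw [not_not.1 h0, zero_pow two_ne_zero]
  simp_rw [h2] at h
  rw [← Finset.sum_filter, Finset.sum_const, nsmul_eq_mul] at h
  have hF : (Fintype.card F : ℚ) ≠ 0 := Nat.cast_ne_zero.2 Fintype.card_ne_zero
  have hk : (Nat.card (LinearMap.ker (polar σ N b)) : ℚ) ≠ 0 :=
    Nat.cast_ne_zero.2 Nat.card_pos.ne'
  rw [eq_div_iff hk]
  apply mul_right_cancel₀ hF
  linear_combination h

end CharacterSums

/-! ### Moments of the sizes of the radicals -/

section Moments

variable {K V β : Type*} [Field K] [AddCommGroup V] [Module K V] [Fintype β] (R : β → Submodule K V)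

open scoped Classical in
/-- The indices `b` for which all the vectors `u i` lie in the subspace `R b`. -/
noncomputable def containing {r : ℕ} (u : Fin r → V) : Finset β :=
  Finset.univ.filter fun b => ∀ i, u i ∈ R b

theorem mem_containing {r : ℕ} {u : Fin r → V} {b : β} :
    b ∈ containing R u ↔ ∀ i, u i ∈ R b := by
  simp [containing]

variable [Fintype K] [Fintype V]

theorem natCard_span {K V : Type*} [Field K] [Fintype K] [AddCommGroup V] [Module K V]
    {r : ℕ} {u : Fin r → V} (hu : LinearIndependent K u) :
    Nat.card (Submodule.span K (Set.range u)) = Fintype.card K ^ r := by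
  have := FiniteDimensional.span_of_finite K (Set.finite_range u)
  rw [Module.natCard_eq_pow_finrank (K := K), finrank_span_eq_card hu, Fintype.card_fin,
    Nat.card_eq_fintype_card]

open scoped Classical in
/-- Averaging over the vectors that extend an independent family `u` inside the subspaces `R b`. -/
theorem sum_containing_sub_one_mul {r : ℕ} {u : Fin r → V} (hu : LinearIndependent K u)
    (f : β → ℚ) :
    ∑ b ∈ containing R u, ((Nat.card (R b) : ℚ) / (Fintype.card K : ℚ) ^ r - 1) * f b
      = ((Fintype.card K : ℚ) ^ r)⁻¹ *
        ∑ x ∈ Finset.univ.filter (fun x => x ∉ Submodule.span K (Set.range u)),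
          ∑ b ∈ containing R (Fin.cons x u : Fin (r + 1) → V), f b := by
  have hq : ((Fintype.card K : ℚ) ^ r) ≠ 0 :=
    pow_ne_zero _ (Nat.cast_ne_zero.2 Fintype.card_ne_zero)
  have h1 : ∀ b ∈ containing R u, (Nat.card (R b) : ℚ) / (Fintype.card K : ℚ) ^ r - 1
      = ((Fintype.card K : ℚ) ^ r)⁻¹ * ((Finset.univ.filter
        (fun x => x ∉ Submodule.span K (Set.range u) ∧ x ∈ R b)).card : ℚ) := fun b hb => by
    have hle : Submodule.span K (Set.range u) ≤ R b := by
      rw [Submodule.span_le]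
      rintro _ ⟨i, rfl⟩
      exact (mem_containing R).1 hb i
    have h2 : (Finset.univ.filter (fun x => x ∉ Submodule.span K (Set.range u) ∧ x ∈ R b))
        = Finset.univ.filter (fun x => x ∈ R b)
          \ Finset.univ.filter (fun x => x ∈ Submodule.span K (Set.range u)) := by
      ext x
      simp [and_comm]
    have h3 : (Finset.univ.filter (fun x => x ∈ R b)).card = Nat.card (R b) := by
      rw [Nat.card_eq_fintype_card, ← Fintype.card_subtype]
    have h4 : (Finset.univ.filter (fun x => x ∈ Submodule.span K (Set.range u))).card
        = Fintype.card K ^ r := by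
      rw [← natCard_span hu, Nat.card_eq_fintype_card, ← Fintype.card_subtype]
    have h5 : Finset.univ.filter (fun x => x ∈ Submodule.span K (Set.range u))
        ⊆ Finset.univ.filter (fun x => x ∈ R b) := fun x => by
      simp only [Finset.mem_filter, Finset.mem_univ, true_and]
      exact fun hx => hle hx
    rw [h2, Finset.cast_card_sdiff h5, h3, h4, Nat.cast_pow]
    field_simp
  rw [Finset.sum_congr rfl fun b hb => by rw [h1 b hb, mul_assoc], ← Finset.mul_sum]
  congr 1
  simp_rw [← nsmul_eq_mul, ← Finset.sum_const]
  rw [Finset.sum_comm' (s' := fun x => containing R (Fin.cons x u : Fin (r + 1) → V))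
    (t' := Finset.univ.filter (fun x => x ∉ Submodule.span K (Set.range u)))]
  intro b x
  simp only [mem_containing, Finset.mem_filter, Finset.mem_univ, true_and, Fin.forall_fin_succ,
    Fin.cons_zero, Fin.cons_succ]
  tauto

variable {R} {κ : ℕ}

/-- The moments `∑_b ∏_{j<v} (|R b| - q^{2j})` of a family of subspaces for which `r ≤ κ` independent
vectors lie in the proportion `q^{r(r+1)/2} / |V|^r` of all members. The induction passes to the
members that contain a given independent family, and it alternates between even and odd powers of
`q`, since dividing by one more vector shifts the sizes by a factor `q`. -/
theorem sum_containing_prod_sub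
    (hR : ∀ r ≤ κ, ∀ u : Fin r → V, LinearIndependent K u →
      ((containing R u).card : ℚ) * (Fintype.card V : ℚ) ^ r
        = Fintype.card β * (Fintype.card K : ℚ) ^ ((r + 1).choose 2))
    (v : ℕ) : ∀ (r : ℕ) (u : Fin r → V), LinearIndependent K u → r + v ≤ κ →
      (∑ b ∈ containing R u, ∏ j ∈ Finset.range v,
          ((Nat.card (R b) : ℚ) / (Fintype.card K : ℚ) ^ r - (Fintype.card K : ℚ) ^ (2 * j))
        = (containing R u).card * (Fintype.card K : ℚ) ^ v * ∏ j ∈ Finset.range v,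
          (1 - (Fintype.card K : ℚ) ^ (2 * j + r) / Fintype.card V)) ∧
      (∑ b ∈ containing R u, ∏ j ∈ Finset.range v,
          ((Nat.card (R b) : ℚ) / (Fintype.card K : ℚ) ^ r - (Fintype.card K : ℚ) ^ (2 * j + 1))
        = (containing R u).card * ∏ j ∈ Finset.range v,
          (1 - (Fintype.card K : ℚ) ^ (2 * j + 1 + r) / Fintype.card V)) := by
  classical
  set q : ℚ := (Fintype.card K : ℚ) with hq_def
  set Q : ℚ := (Fintype.card V : ℚ) with hQ_def
  have hq : q ≠ 0 := Nat.cast_ne_zero.2 Fintype.card_ne_zero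
  have hQ : Q ≠ 0 := Nat.cast_ne_zero.2 Fintype.card_ne_zero
  induction v with
  | zero => intro r u _ _; simp
  | succ v ih =>
    intro r u hu hrv
    have hcons : ∀ x ∈ Finset.univ.filter (fun x => x ∉ Submodule.span K (Set.range u)),
        LinearIndependent K (Fin.cons x u : Fin (r + 1) → V) := fun x hx =>
      linearIndependent_finCons.2 ⟨hu, (Finset.mem_filter.1 hx).2⟩
    -- one more vector divides the number of members by `|V| / q ^ (r + 1)`
    have hcard : ∀ x ∈ Finset.univ.filter (fun x => x ∉ Submodule.span K (Set.range u)),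
        ((containing R (Fin.cons x u : Fin (r + 1) → V)).card : ℚ)
          = (containing R u).card * q ^ (r + 1) / Q := fun x hx => by
      have h1 := hR r (by omega) u hu
      have h2 := hR (r + 1) (by omega) _ (hcons x hx)
      rw [Nat.choose_succ_succ' (r + 1) 1, Nat.choose_one_right, pow_add] at h2
      rw [eq_div_iff hQ]
      apply mul_right_cancel₀ (pow_ne_zero r hQ)
      linear_combination h2 - q ^ (r + 1) * h1
    have hnum : ((Finset.univ.filter (fun x => x ∉ Submodule.span K (Set.range u))).card : ℚ)
        = Q - q ^ r := by
      rw [Finset.filter_not, Finset.cast_card_sdiff (Finset.subset_univ _), Finset.card_univ]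
      congr 1
      rw [hq_def, ← Nat.cast_pow, ← natCard_span hu, Nat.card_eq_fintype_card,
        ← Fintype.card_subtype]
    have hstep : ∀ (f : β → ℚ) (C : ℚ),
        (∀ x ∈ Finset.univ.filter (fun x => x ∉ Submodule.span K (Set.range u)),
          ∑ b ∈ containing R (Fin.cons x u : Fin (r + 1) → V), f b
            = (containing R (Fin.cons x u : Fin (r + 1) → V)).card * C) →
        ∑ b ∈ containing R u, ((Nat.card (R b) : ℚ) / q ^ r - 1) * f b
          = (containing R u).card * (q * (1 - q ^ r / Q)) * C := fun f C h => by
      rw [sum_containing_sub_one_mul R hu, Finset.sum_congr rfl fun x hx => by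
        rw [h x hx, hcard x hx], Finset.sum_const, nsmul_eq_mul, hnum, ← hq_def,
        pow_succ]
      field_simp
    have hY : ∀ b, (Nat.card (R b) : ℚ) / q ^ r = q * ((Nat.card (R b) : ℚ) / q ^ (r + 1)) :=
      fun b => by rw [pow_succ]; field_simp
    constructor
    -- for the even powers the factor `X - 1` splits off, and the others become odd powers
    · have h := hstep (fun b => q ^ v * ∏ j ∈ Finset.range v,
          ((Nat.card (R b) : ℚ) / q ^ (r + 1) - q ^ (2 * j + 1))) (q ^ v * ∏ j ∈ Finset.range v,
          (1 - q ^ (2 * j + 1 + (r + 1)) / Q)) fun x hx => by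
        rw [← Finset.mul_sum, (ih (r + 1) _ (hcons x hx) (by omega)).2]
        ring
      have e : ∀ b, ∏ j ∈ Finset.range (v + 1), ((Nat.card (R b) : ℚ) / q ^ r - q ^ (2 * j))
          = ((Nat.card (R b) : ℚ) / q ^ r - 1) * (q ^ v * ∏ j ∈ Finset.range v,
            ((Nat.card (R b) : ℚ) / q ^ (r + 1) - q ^ (2 * j + 1))) := fun b => by
        rw [Finset.prod_range_succ', mul_comm, mul_zero, pow_zero]
        congr 1
        have : q ^ v = ∏ _j ∈ Finset.range v, q := by simp
        rw [this, ← Finset.prod_mul_distrib]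
        refine Finset.prod_congr rfl fun j _ => ?_
        rw [hY]
        ring
      rw [Finset.sum_congr rfl fun b _ => e b, h, Finset.prod_range_succ']
      have e2 : ∏ j ∈ Finset.range v, (1 - q ^ (2 * j + 1 + (r + 1)) / Q)
          = ∏ j ∈ Finset.range v, (1 - q ^ (2 * (j + 1) + r) / Q) :=
        Finset.prod_congr rfl fun j _ => by ring_nf
      rw [e2, mul_zero, zero_add]
      ring
    -- for the odd powers the last factor is written as `(X - 1) + (1 - q ^ (2 * v + 1))`
    · have h := hstep (fun b => q ^ v * ∏ j ∈ Finset.range v,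
          ((Nat.card (R b) : ℚ) / q ^ (r + 1) - q ^ (2 * j)))
          (q ^ (2 * v) * ∏ j ∈ Finset.range v, (1 - q ^ (2 * j + (r + 1)) / Q)) fun x hx => by
        rw [← Finset.mul_sum, (ih (r + 1) _ (hcons x hx) (by omega)).1]
        ring
      have e : ∀ b, ∏ j ∈ Finset.range (v + 1), ((Nat.card (R b) : ℚ) / q ^ r - q ^ (2 * j + 1))
          = ((Nat.card (R b) : ℚ) / q ^ r - 1) * (q ^ v * ∏ j ∈ Finset.range v,
            ((Nat.card (R b) : ℚ) / q ^ (r + 1) - q ^ (2 * j)))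
            + (1 - q ^ (2 * v + 1)) * ∏ j ∈ Finset.range v,
              ((Nat.card (R b) : ℚ) / q ^ r - q ^ (2 * j + 1)) := fun b => by
        have e1 : q ^ v * ∏ j ∈ Finset.range v, ((Nat.card (R b) : ℚ) / q ^ (r + 1) - q ^ (2 * j))
            = ∏ j ∈ Finset.range v, ((Nat.card (R b) : ℚ) / q ^ r - q ^ (2 * j + 1)) := by
          have : q ^ v = ∏ _j ∈ Finset.range v, q := by simp
          rw [this, ← Finset.prod_mul_distrib]
          refine Finset.prod_congr rfl fun j _ => ?_
          rw [hY]
          ring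
        rw [e1, Finset.prod_range_succ]
        ring
      rw [Finset.sum_congr rfl fun b _ => e b, Finset.sum_add_distrib, h, ← Finset.mul_sum,
        (ih r u hu (by omega)).2, Finset.prod_range_succ]
      have e2 : ∏ j ∈ Finset.range v, (1 - q ^ (2 * j + (r + 1)) / Q)
          = ∏ j ∈ Finset.range v, (1 - q ^ (2 * j + 1 + r) / Q) :=
        Finset.prod_congr rfl fun j _ => by ring_nf
      rw [e2]
      ring

/-- Newton interpolation of `X⁻¹` at the nodes `q ^ (2 * j)`. -/
theorem inv_eq_sum_prod_sub {q X : ℚ} (hq : q ≠ 0) (hX : X ≠ 0) (κ : ℕ) :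
    X⁻¹ = ∑ v ∈ Finset.range κ, (-1) ^ v * (q ^ (v * (v + 1)))⁻¹ *
        ∏ j ∈ Finset.range v, (X - q ^ (2 * j))
      + (-1) ^ κ * (∏ j ∈ Finset.range κ, q ^ (2 * j))⁻¹ * X⁻¹ *
        ∏ j ∈ Finset.range κ, (X - q ^ (2 * j)) := by
  induction κ with
  | zero => simp
  | succ κ ih =>
    have h : ∀ n, ∏ j ∈ Finset.range (n + 1), q ^ (2 * j) = q ^ (n * (n + 1)) := fun n => by
      induction n with
      | zero => simp
      | succ n ihn => rw [Finset.prod_range_succ, ihn, ← pow_add]; congr 1; ring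
    nth_rewrite 1 [ih]
    have h1 := h κ
    rw [h κ, Finset.sum_range_succ, add_assoc]
    congr 1
    rw [Finset.prod_range_succ] at h1
    rw [← h1, Finset.prod_range_succ (fun j => X - q ^ (2 * j))]
    have h2 : (∏ j ∈ Finset.range κ, q ^ (2 * j)) ≠ 0 :=
      Finset.prod_ne_zero_iff.2 fun j _ => pow_ne_zero _ hq
    have h3 : q ^ (2 * κ) ≠ 0 := pow_ne_zero _ hq
    field_simp
    ring

open scoped Classical in
/-- The sum of the reciprocals of the sizes of the subspaces: on the proper subspaces of the family
the function `X⁻¹` agrees with a polynomial of degree `κ`, whose sum the moments give. -/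
theorem sum_inv_natCard
    (hR : ∀ r ≤ κ, ∀ u : Fin r → V, LinearIndependent K u →
      ((containing R u).card : ℚ) * (Fintype.card V : ℚ) ^ r
        = Fintype.card β * (Fintype.card K : ℚ) ^ ((r + 1).choose 2))
    (hcard : ∀ b, R b ≠ ⊤ → ∃ i ≤ κ, Nat.card (R b) = Fintype.card K ^ (2 * i)) :
    ∑ b, (Nat.card (R b) : ℚ)⁻¹
      = ∑ v ∈ Finset.range (κ + 1), (-1) ^ v * ((Fintype.card K : ℚ) ^ (v * (v + 1)))⁻¹ *
          (Fintype.card β * (Fintype.card K : ℚ) ^ v *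
              ∏ j ∈ Finset.range v, (1 - (Fintype.card K : ℚ) ^ (2 * j) / Fintype.card V)
            - (Finset.univ.filter fun b => R b = ⊤).card *
              ∏ j ∈ Finset.range v, ((Fintype.card V : ℚ) - (Fintype.card K : ℚ) ^ (2 * j)))
        + (Finset.univ.filter fun b => R b = ⊤).card / Fintype.card V := by
  set q : ℚ := (Fintype.card K : ℚ) with hq_def
  set Q : ℚ := (Fintype.card V : ℚ) with hQ_def
  have hq : q ≠ 0 := Nat.cast_ne_zero.2 Fintype.card_ne_zero
  let P : ℚ → ℚ := fun X => ∑ v ∈ Finset.range (κ + 1), (-1) ^ v * (q ^ (v * (v + 1)))⁻¹ *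
        ∏ j ∈ Finset.range v, (X - q ^ (2 * j))
  have h1 : ∀ b, (Nat.card (R b) : ℚ)⁻¹ = P (Nat.card (R b))
      + if R b = ⊤ then Q⁻¹ - P Q else 0 := fun b => by
    split_ifs with hb
    · have : Nat.card (R b) = Fintype.card V := by
        rw [hb, ← Nat.card_eq_fintype_card]
        exact Nat.card_congr Submodule.topEquiv.toEquiv
      rw [this]
      ring
    · obtain ⟨i, hi, hX⟩ := hcard b hb
      rw [add_zero, inv_eq_sum_prod_sub hq (Nat.cast_ne_zero.2 Nat.card_pos.ne') (κ + 1)]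
      rw [add_eq_left]
      refine mul_eq_zero_of_right _ (Finset.prod_eq_zero (Finset.mem_range.2 (by omega : i < κ + 1))
        ?_)
      rw [hX, Nat.cast_pow, sub_self]
  have h2 : ∀ v ∈ Finset.range (κ + 1),
      ∑ b, ∏ j ∈ Finset.range v, ((Nat.card (R b) : ℚ) - q ^ (2 * j))
        = Fintype.card β * q ^ v * ∏ j ∈ Finset.range v, (1 - q ^ (2 * j) / Q) := fun v hv => by
    have h3 := (sum_containing_prod_sub hR v 0 ![] (linearIndependent_empty_type)
      (by rw [Finset.mem_range] at hv; omega)).1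
    have h4 : containing R (![] : Fin 0 → V) = Finset.univ := by
      ext b
      simp [mem_containing]
    simpa only [h4, pow_zero, div_one, add_zero, Finset.card_univ] using h3
  simp_rw [h1]
  rw [Finset.sum_add_distrib, Finset.sum_comm, ← Finset.sum_filter, Finset.sum_const, nsmul_eq_mul]
  rw [Finset.sum_congr rfl fun v hv => by rw [← Finset.mul_sum, h2 v hv]]
  have h5 : ∀ (A B C : ℕ → ℚ) (t : ℚ), ∑ v ∈ Finset.range (κ + 1), A v * B v
      + t * (Q⁻¹ - ∑ v ∈ Finset.range (κ + 1), A v * C v)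
      = ∑ v ∈ Finset.range (κ + 1), A v * (B v - t * C v) + t / Q := fun A B C t => by
    simp_rw [mul_sub, Finset.sum_sub_distrib, mul_left_comm _ t, ← Finset.mul_sum]
    ring
  exact h5 (fun v => (-1) ^ v * (q ^ (v * (v + 1)))⁻¹) _ _ _

end Moments

/-! ### Maximum-length sequences and finite fields -/

section MaxLength

open Polynomial

variable {M : ℕ}

/-- The one-step circular shift as an operator on sequences. -/
def shiftMap (M : ℕ) : BinSeq M →ₗ[ZMod 2] BinSeq M :=
  LinearMap.funLeft (ZMod 2) (ZMod 2) fun i => i + 1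

theorem shiftMap_pow_apply (t : ℕ) (c : BinSeq M) :
    (shiftMap M ^ t) c = BinSeq.shift (t : ZMod M) c := by
  induction t with
  | zero => funext i; simp [BinSeq.shift]
  | succ t ih =>
    rw [pow_succ', Module.End.mul_apply, ih]
    funext i
    simp only [shiftMap, LinearMap.funLeft_apply, BinSeq.shift]
    congr 1
    push_cast
    ring

/-- The polynomials in the shift operator that annihilate `s`. -/
noncomputable def annihilatingIdeal (s : BinSeq M) : Ideal (ZMod 2)[X] where
  carrier := {p | aeval (shiftMap M) p s = 0}
  add_mem' {p q} hp hq := by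
    simp only [Set.mem_ofPred_eq] at hp hq ⊢
    rw [map_add, LinearMap.add_apply, hp, hq, add_zero]
  zero_mem' := by simp
  smul_mem' p q hq := by
    simp only [Set.mem_ofPred_eq] at hq ⊢
    rw [smul_eq_mul, map_mul, Module.End.mul_apply, hq, map_zero]

theorem mem_annihilatingIdeal {s : BinSeq M} {p : (ZMod 2)[X]} :
    p ∈ annihilatingIdeal s ↔ aeval (shiftMap M) p s = 0 := Iff.rfl

theorem aeval_X_pow_apply (s : BinSeq M) (t : ℕ) :
    aeval (shiftMap M) (X ^ t : (ZMod 2)[X]) s = BinSeq.shift (t : ZMod M) s := by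
  rw [map_pow, aeval_X, shiftMap_pow_apply]

variable {r : ℕ} {s : BinSeq (2 ^ r - 1)}

theorem isMaxLength_shift_injective (hs : BinSeq.IsMaxLength r s) :
    Function.Injective fun t => BinSeq.shift t s := by
  intro t t' h
  refine sub_eq_zero.1 (hs.period (t - t') ?_)
  funext i
  have := congrFun h (i - t')
  simp only [BinSeq.shift] at this ⊢
  rw [show i + (t - t') = i - t' + t by ring, this, sub_add_cancel]

/-- The shifts of a maximum-length sequence are all the nonzero solutions of its recurrence, so a
polynomial in the shift operator maps it to zero or to one of its shifts. -/
theorem exists_aeval_eq_shift (hr : 0 < r) (hs : BinSeq.IsMaxLength r s) (p : (ZMod 2)[X])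
    (hp : p ∉ annihilatingIdeal s) :
    ∃ t : ℕ, aeval (shiftMap (2 ^ r - 1)) p s = BinSeq.shift (t : ZMod (2 ^ r - 1)) s := by
  classical
  have hM : 2 ^ r - 1 ≠ 0 := by
    have := Nat.one_lt_two_pow hr.ne'
    omega
  have : NeZero (2 ^ r - 1) := ⟨hM⟩
  obtain ⟨E, hE, hsol⟩ := hs.recurrence
  let W : Submodule (ZMod 2) (BinSeq (2 ^ r - 1)) :=
    E.solSpace.comap (LinearMap.funLeft (ZMod 2) (ZMod 2) fun i : ℕ => (i : ZMod (2 ^ r - 1)))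
  have hshift : ∀ t : ZMod (2 ^ r - 1), BinSeq.shift t s ∈ W := fun t n => by
    have := hsol (n + t.val)
    simp only [LinearMap.funLeft_apply, BinSeq.shift, Nat.cast_add, ZMod.natCast_val,
      ZMod.cast_id', id_eq] at this ⊢
    rw [show (n : ZMod (2 ^ r - 1)) + E.order + t = n + t + E.order by ring, this]
    refine Finset.sum_congr rfl fun i _ => ?_
    rw [show (n : ZMod (2 ^ r - 1)) + t + (i : ℕ) = n + (i : ℕ) + t by ring]
  have hcard : Nat.card W ≤ 2 ^ r := by
    have hinj : Function.Injective fun (w : W) (i : Fin E.order) =>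
        (w : BinSeq (2 ^ r - 1)) ((i : ℕ) : ZMod (2 ^ r - 1)) := by
      intro w w' h
      have := (E.eq_iff_eqOn_range_order _ _ w.2 w'.2).2 fun i hi =>
        congrFun h ⟨i, by simpa using hi⟩
      ext i
      have := congrFun this i.val
      simpa [LinearMap.funLeft_apply] using this
    have := Nat.card_le_card_of_injective _ hinj
    simpa [hE] using this
  have hmem : ∀ q : (ZMod 2)[X], aeval (shiftMap (2 ^ r - 1)) q s ∈ W := fun q => by
    rw [aeval_eq_sum_range, LinearMap.sum_apply]
    refine Submodule.sum_mem _ fun i _ => ?_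
    rw [LinearMap.smul_apply, shiftMap_pow_apply]
    exact W.smul_mem _ (hshift _)
  have himage : Finset.univ.image (fun t => BinSeq.shift t s)
      = (Finset.univ.filter fun c => c ∈ W).erase 0 := by
    refine Finset.eq_of_subset_of_card_le ?_ ?_
    · intro c hc
      obtain ⟨t, -, rfl⟩ := Finset.mem_image.1 hc
      refine Finset.mem_erase.2 ⟨fun h0 => hs.ne_zero ?_, by simpa using hshift t⟩
      funext i
      have := congrFun h0 (i - t)
      simpa [BinSeq.shift] using this
    · rw [Finset.card_image_of_injective _ (isMaxLength_shift_injective hs), Finset.card_univ,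
        ZMod.card, Finset.card_erase_of_mem (by simp), ← Fintype.card_subtype]
      rw [Nat.card_eq_fintype_card] at hcard
      exact Nat.sub_le_sub_right hcard 1
  have : aeval (shiftMap (2 ^ r - 1)) p s ∈ Finset.univ.image (fun t => BinSeq.shift t s) := by
    rw [himage]
    exact Finset.mem_erase.2 ⟨hp, by simpa using hmem p⟩
  obtain ⟨t, -, ht⟩ := Finset.mem_image.1 this
  exact ⟨t.val, by rw [← ht]; simp⟩

theorem annihilatingIdeal_isMaximal (hr : 0 < r) (hs : BinSeq.IsMaxLength r s) :
    (annihilatingIdeal s).IsMaximal := by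
  rw [Ideal.isMaximal_iff]
  refine ⟨fun h => hs.ne_zero (by simpa [mem_annihilatingIdeal] using h), fun J p hJ hp hpJ => ?_⟩
  have : NeZero (2 ^ r - 1) := ⟨by have := Nat.one_lt_two_pow hr.ne'; omega⟩
  obtain ⟨t, ht⟩ := exists_aeval_eq_shift hr hs p hp
  have hmem : X ^ ((-(t : ZMod (2 ^ r - 1))).val) * p - 1 ∈ annihilatingIdeal s := by
    rw [mem_annihilatingIdeal, map_sub, map_mul, map_one, LinearMap.sub_apply,
      Module.End.mul_apply, ht, Module.End.one_apply, aeval_X_pow_apply, sub_eq_zero]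
    funext i
    simp [BinSeq.shift]
  have := J.sub_mem (J.mul_mem_left (X ^ ((-(t : ZMod (2 ^ r - 1))).val)) hpJ) (hJ hmem)
  simpa using this

theorem exists_trace_mul_eq {F : Type*} [Field F] [Finite F] [Algebra (ZMod 2) F]
    (φ : F →ₗ[ZMod 2] ZMod 2) : ∃ θ : F, ∀ x, φ x = Algebra.trace (ZMod 2) F (θ * x) := by
  refine ⟨((Algebra.traceForm (ZMod 2) F).toDual (traceForm_nondegenerate _ _)).symm φ,
    fun x => ?_⟩
  have := LinearMap.BilinForm.apply_toDual_symm_apply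
    (hB := traceForm_nondegenerate (ZMod 2) F) φ x
  rw [← this, Algebra.traceForm_apply]

/-- A maximum-length sequence is `i ↦ Tr(θ α^i)` for a primitive element `α` of the field with `2 ^ r`
elements; the field is the quotient of the polynomial ring by the annihilator of `s`, and `α` is the
class of the shift operator. -/
theorem exists_field_of_isMaxLength (hr : 0 < r) (hs : BinSeq.IsMaxLength r s) :
    ∃ (F : Type) (_ : Field F) (_ : Fintype F) (_ : Algebra (ZMod 2) F) (α : Fˣ) (θ : F),
      Fintype.card F = 2 ^ r ∧ orderOf α = 2 ^ r - 1 ∧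
        ∀ i : ℕ, s (i : ZMod (2 ^ r - 1)) = Algebra.trace (ZMod 2) F (θ * (α : F) ^ i) := by
  classical
  have hpos := Nat.one_lt_two_pow hr.ne'
  have : NeZero (2 ^ r - 1) := ⟨by omega⟩
  have hmax := annihilatingIdeal_isMaximal hr hs
  let : Field ((ZMod 2)[X] ⧸ annihilatingIdeal s) := Ideal.Quotient.field _
  let mk : (ZMod 2)[X] →+* (ZMod 2)[X] ⧸ annihilatingIdeal s := Ideal.Quotient.mk _
  have hmk : ∀ p q, mk p = mk q ↔
      aeval (shiftMap (2 ^ r - 1)) p s = aeval (shiftMap (2 ^ r - 1)) q s := fun p q => by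
    rw [Ideal.Quotient.mk_eq_mk_iff_sub_mem, mem_annihilatingIdeal, map_sub, LinearMap.sub_apply,
      sub_eq_zero]
  have hmk0 : ∀ p, mk p = 0 ↔ p ∈ annihilatingIdeal s := fun p =>
    Ideal.Quotient.eq_zero_iff_mem
  have hX : mk X ≠ 0 := fun h => hs.ne_zero <| by
    rw [hmk0, mem_annihilatingIdeal, aeval_X] at h
    funext i
    have := congrFun h (i - 1)
    simpa [shiftMap, LinearMap.funLeft_apply] using this
  let g : Option (ZMod (2 ^ r - 1)) → (ZMod 2)[X] ⧸ annihilatingIdeal s :=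
    fun t => t.elim 0 fun t => mk (X ^ t.val)
  have hg : Function.Surjective g := fun x => by
    obtain ⟨p, rfl⟩ := Ideal.Quotient.mk_surjective x
    by_cases hp : p ∈ annihilatingIdeal s
    · exact ⟨none, ((hmk0 p).2 hp).symm⟩
    · obtain ⟨t, ht⟩ := exists_aeval_eq_shift hr hs p hp
      refine ⟨some t, (hmk _ _).2 ?_⟩
      rw [ht, aeval_X_pow_apply]
      simp
  let : Fintype ((ZMod 2)[X] ⧸ annihilatingIdeal s) := Fintype.ofSurjective g hg
  let α : ((ZMod 2)[X] ⧸ annihilatingIdeal s)ˣ := Units.mk0 (mk X) hX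
  have hα : orderOf α = 2 ^ r - 1 := by
    have h1 : ∀ i : ℕ, α ^ i = 1 ↔ 2 ^ r - 1 ∣ i := fun i => by
      rw [← Units.val_inj, Units.val_pow_eq_pow_val, Units.val_one]
      change mk X ^ i = 1 ↔ _
      rw [← map_pow, ← map_one mk, hmk, aeval_X_pow_apply, map_one, Module.End.one_apply,
        ← ZMod.natCast_eq_zero_iff]
      refine ⟨hs.period _, fun h => ?_⟩
      rw [h]
      funext i
      simp [BinSeq.shift]
    exact Nat.dvd_antisymm (orderOf_dvd_iff_pow_eq_one.2 ((h1 _).2 dvd_rfl))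
      ((h1 _).1 (pow_orderOf_eq_one α))
  have hcard : Fintype.card ((ZMod 2)[X] ⧸ annihilatingIdeal s) = 2 ^ r := by
    refine le_antisymm ?_ ?_
    · have := Fintype.card_le_of_surjective g hg
      rw [Fintype.card_option, ZMod.card] at this
      omega
    · have := orderOf_le_card_univ (x := α)
      rw [hα, Fintype.card_units] at this
      omega
  let ψ : (ZMod 2)[X] ⧸ annihilatingIdeal s → ZMod 2 := fun x =>
    aeval (shiftMap (2 ^ r - 1)) (Function.surjInv Ideal.Quotient.mk_surjective x) s 0
  have hψ : ∀ p, ψ (mk p) = aeval (shiftMap (2 ^ r - 1)) p s 0 := fun p => by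
    refine congrFun ((hmk _ _).1 ?_) 0
    exact Function.surjInv_eq Ideal.Quotient.mk_surjective (mk p)
  let φ : ((ZMod 2)[X] ⧸ annihilatingIdeal s) →ₗ[ZMod 2] ZMod 2 :=
    AddMonoidHom.toZModLinearMap 2
      { toFun := ψ
        map_zero' := by rw [← map_zero mk, hψ]; simp
        map_add' := fun x y => by
          obtain ⟨p, rfl⟩ := Ideal.Quotient.mk_surjective x
          obtain ⟨q, rfl⟩ := Ideal.Quotient.mk_surjective y
          change ψ (mk p + mk q) = ψ (mk p) + ψ (mk q)
          rw [← map_add, hψ, hψ, hψ, map_add, LinearMap.add_apply, Pi.add_apply] }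
  obtain ⟨θ, hθ⟩ := exists_trace_mul_eq φ
  refine ⟨_, inferInstance, inferInstance, inferInstance, α, θ, hcard, hα, fun i => ?_⟩
  rw [← hθ]
  change s i = ψ (mk X ^ i)
  rw [← map_pow, hψ, aeval_X_pow_apply]
  simp [BinSeq.shift]

end MaxLength

/-! ### The trace character and the Galois group -/

/-- The nontrivial character of `𝔽₂` with values `±1`. -/
def signChar : AddChar (ZMod 2) ℚ where
  toFun z := (-1) ^ z.val
  map_zero_eq_one' := by simp
  map_add_eq_mul' a b := by
    have h : ∀ a b : ZMod 2, (-1 : ℤ) ^ (a + b).val = (-1) ^ a.val * (-1) ^ b.val := by decide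
    exact_mod_cast h a b

theorem signChar_apply (z : ZMod 2) : signChar z = (-1) ^ z.val := rfl

theorem signChar_eq_one_iff {z : ZMod 2} : signChar z = 1 ↔ z = 0 := by
  have h : ∀ z : ZMod 2, (-1 : ℤ) ^ z.val = 1 ↔ z = 0 := by decide
  rw [signChar_apply, ← h z]
  exact_mod_cast Iff.rfl

section TraceChar

variable (F : Type*) [Field F] [Finite F] [Algebra (ZMod 2) F]

/-- The character `x ↦ (-1)^{Tr x}` of a field of characteristic two. -/
noncomputable def traceChar : AddChar F ℚ :=
  signChar.compAddMonoidHom (Algebra.trace (ZMod 2) F).toAddMonoidHom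

variable {F}

omit [Finite F] in
theorem traceChar_eq_one_iff {x : F} : traceChar F x = 1 ↔ Algebra.trace (ZMod 2) F x = 0 :=
  signChar_eq_one_iff

theorem traceChar_isPrimitive : (traceChar F).IsPrimitive := by
  intro a ha h
  refine ha ((traceForm_nondegenerate (ZMod 2) F).1 a fun x => ?_)
  rw [Algebra.traceForm_apply, ← traceChar_eq_one_iff, ← AddChar.mulShift_apply, h,
    AddChar.one_apply]

omit [Finite F] in
theorem trace_apply_eq {K : Type*} [Field K] [Algebra K F] (σ : F ≃ₐ[K] F) (x : F) :
    Algebra.trace (ZMod 2) F (σ x) = Algebra.trace (ZMod 2) F x :=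
  Algebra.trace_eq_of_algEquiv (AlgEquiv.ofRingEquiv (f := (σ : F ≃+* F)) fun c =>
    RingHom.congr_fun (Subsingleton.elim (((σ : F ≃+* F) : F →+* F).comp (algebraMap (ZMod 2) F))
      (algebraMap (ZMod 2) F)) c) x

omit [Finite F] in
theorem traceChar_apply_eq {K : Type*} [Field K] [Algebra K F] (σ : F ≃ₐ[K] F) (x : F) :
    traceChar F (σ x) = traceChar F x :=
  congrArg signChar (trace_apply_eq σ x)

end TraceChar

/-- The index of the fixed field of `τ` is the order of `τ`, written in terms of cardinalities. -/
theorem natCard_fixed_pow_orderOf {k F : Type*} [Field k] [Field F] [Algebra k F] [Finite F]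
    (τ : F ≃ₐ[k] F) : Nat.card {x // τ x = x} ^ orderOf τ = Nat.card F := by
  have : FiniteDimensional k F := Module.Finite.of_finite
  let L := IntermediateField.fixedField (Subgroup.zpowers τ)
  have hL : finrank L F = orderOf τ := by
    rw [IntermediateField.finrank_fixedField_eq_card, Nat.card_zpowers]
  have hcard : Nat.card L = Nat.card {x // τ x = x} := by
    refine Nat.card_congr (Equiv.subtypeEquivRight fun x => ?_)
    rw [IntermediateField.mem_fixedField_iff]
    refine ⟨fun h => h τ (Subgroup.mem_zpowers τ), fun h f hf => ?_⟩
    have hle : Subgroup.zpowers τ ≤ MulAction.stabilizer (F ≃ₐ[k] F) x := by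
      rw [Subgroup.zpowers_le]
      exact h
    exact hle hf
  rw [← hcard, ← hL, ← Module.natCard_eq_pow_finrank]

theorem algEquiv_pow_apply {K F : Type*} [Field K] [Field F] [Algebra K F] {σ : F ≃ₐ[K] F} {d : ℕ}
    (hσ : ∀ x, σ x = x ^ 2 ^ d) (l : ℕ) (x : F) : (σ ^ l) x = x ^ 2 ^ (l * d) := by
  induction l with
  | zero => simp
  | succ l ih => rw [pow_succ', AlgEquiv.mul_apply, ih, hσ, ← pow_mul, ← pow_add]; congr 2; ring

/-- The `d`-th power `σ` of the Frobenius automorphism, regarded as an automorphism over its fixed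
field `K`, with its order and the number of fixed points of its powers. -/
theorem exists_fixedField {F : Type*} [Field F] [Fintype F] [Algebra (ZMod 2) F] {m d : ℕ}
    (hF : Fintype.card F = 2 ^ m) :
    ∃ (K : IntermediateField (ZMod 2) F) (σ : F ≃ₐ[K] F), (∀ x, σ x = x ^ 2 ^ d) ∧
      (∀ x, σ x = x → ∃ c : K, algebraMap K F c = x) ∧ finrank K F = m / m.gcd d ∧
      orderOf σ = m / m.gcd d ∧
      ∀ l, Nat.card {x // (σ ^ l) x = x} ^ (m / m.gcd d / (m / m.gcd d).gcd l) = 2 ^ m := by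
  let φ := FiniteField.frobeniusAlgEquivOfAlgebraic (ZMod 2) F
  let τ := φ ^ d
  have hfr : finrank (ZMod 2) F = m := by
    have := Module.card_eq_pow_finrank (K := ZMod 2) (V := F)
    rw [hF, ZMod.card] at this
    exact (Nat.pow_right_injective le_rfl this).symm
  have hτ : ∀ x, τ x = x ^ 2 ^ d := fun x => by
    have := algEquiv_pow_apply (σ := φ) (d := 1) (fun x => by
      simp [φ]) d x
    rw [mul_one] at this
    exact this
  have hord : orderOf τ = m / m.gcd d := by
    rw [orderOf_pow, FiniteField.orderOf_frobeniusAlgEquivOfAlgebraic, hfr]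
  let K := IntermediateField.fixedField (Subgroup.zpowers τ)
  have hmem : ∀ x, x ∈ K ↔ τ x = x := fun x => by
    rw [IntermediateField.mem_fixedField_iff]
    refine ⟨fun h => h τ (Subgroup.mem_zpowers τ), fun h f hf => ?_⟩
    have hle : Subgroup.zpowers τ ≤ MulAction.stabilizer (F ≃ₐ[ZMod 2] F) x := by
      rw [Subgroup.zpowers_le]
      exact h
    exact hle hf
  let σ : F ≃ₐ[K] F := AlgEquiv.ofRingEquiv (f := (τ : F ≃+* F)) fun c => (hmem c).1 c.2
  have hσ : ∀ l x, (σ ^ l) x = (τ ^ l) x := fun l x => by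
    rw [algEquiv_pow_apply hτ, algEquiv_pow_apply (σ := σ) hτ]
  refine ⟨K, σ, hτ, fun x hx => ⟨⟨x, (hmem x).2 hx⟩, rfl⟩, ?_, ?_, fun l => ?_⟩
  · rw [IntermediateField.finrank_fixedField_eq_card, Nat.card_zpowers, hord]
  · rw [← hord]
    refine orderOf_eq_orderOf_iff.2 fun l => ?_
    rw [AlgEquiv.ext_iff, AlgEquiv.ext_iff]
    exact forall_congr' fun x => by rw [hσ]; rfl
  · have := natCard_fixed_pow_orderOf (τ ^ l)
    rw [orderOf_pow, hord, Nat.card_eq_fintype_card (α := F), hF] at this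
    rw [← this]
    simp only [hσ]

/-! ### Parametrization of the code -/

section Code

variable {K F : Type*} [Field K] [Field F] [Fintype F] [Algebra K F] [Algebra (ZMod 2) F]
  {σ : F ≃ₐ[K] F} {N κ : ℕ}

omit [Fintype F] [Algebra (ZMod 2) F] in
theorem quad_add_left (b b' : Fin (κ + 1) → F) (x : F) :
    quad σ N (b + b') x = quad σ N b x + quad σ N b' x := by
  simp only [quad, Pi.add_apply, add_mul, Finset.sum_add_distrib]

omit [Fintype F] [Algebra (ZMod 2) F] in
theorem quad_single (j : Fin (κ + 1)) (c x : F) :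
    quad σ N (Pi.single j c) x = c * (x * (σ ^ (N - j : ℕ)) x) := by
  rw [quad, Finset.sum_eq_single j]
  · simp
  · intro i _ hi
    simp [Pi.single_eq_of_ne hi]
  · simp

/-- The sequence `i ↦ Tr(a x_i + Q_b(x_i))`, where `x_i = α ^ i`. -/
noncomputable def codeword (σ : F ≃ₐ[K] F) (N κ M : ℕ) (α : Fˣ) :
    F × (Fin (κ + 1) → F) →ₗ[ZMod 2] BinSeq M :=
  AddMonoidHom.toZModLinearMap 2
    { toFun := fun p i =>
        Algebra.trace (ZMod 2) F (p.1 * (α : F) ^ i.val + quad σ N p.2 ((α : F) ^ i.val))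
      map_zero' := by
        funext i
        simp [quad]
      map_add' := fun p p' => by
        funext i
        rw [Pi.add_apply, ← map_add, Prod.fst_add, Prod.snd_add, quad_add_left]
        congr 1
        ring }

omit [Fintype F] in
theorem codeword_apply {M : ℕ} (α : Fˣ) (p : F × (Fin (κ + 1) → F)) (i : ZMod M) :
    codeword σ N κ M α p i
      = Algebra.trace (ZMod 2) F (p.1 * (α : F) ^ i.val + quad σ N p.2 ((α : F) ^ i.val)) := rfl

omit [Fintype F] in
/-- If `c` is fixed by the involution `σ ^ N`, then so is `c x σ^N(x)`, and an element fixed by an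
involution `τ` has the form `y + τ y`, hence trace zero. -/
theorem trace_mul_norm_eq_zero (hσ : σ ^ (2 * N) = 1) (hσN : σ ^ N ≠ 1) {c : F}
    (hc : c + (σ ^ N) c = 0) (x : F) :
    Algebra.trace (ZMod 2) F (c * (x * (σ ^ N) x)) = 0 := by
  have h2 : CharP F 2 := charP_of_injective_algebraMap (algebraMap (ZMod 2) F).injective 2
  have hinv : ∀ x, (σ ^ N) ((σ ^ N) x) = x := fun x => by
    rw [← AlgEquiv.mul_apply, ← pow_add, ← two_mul, hσ, AlgEquiv.one_apply]
  obtain ⟨y, hy⟩ : ∃ y, (σ ^ N) y ≠ y := by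
    by_contra! h
    exact hσN (AlgEquiv.ext h)
  set τ := σ ^ N
  have hw : y + τ y ≠ 0 := fun h => hy (CharTwo.add_eq_zero.1 h).symm
  have hτw : τ (y + τ y) = y + τ y := by rw [map_add, hinv, add_comm]
  have hτz : τ (c * (x * τ x)) = c * (x * τ x) := by
    rw [map_mul, map_mul, hinv, ← CharTwo.add_eq_zero.1 hc]
    ring
  have hz : c * (x * τ x) = c * (x * τ x) / (y + τ y) * y
      + τ (c * (x * τ x) / (y + τ y) * y) := by
    rw [map_mul, map_div₀, hτz, hτw]
    field_simp
  rw [hz, map_add, trace_apply_eq, CharTwo.add_self_eq_zero]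

/-- The form of `b` vanishes identically as soon as its polar form does. -/
theorem trace_quad_eq_zero (hfix : ∀ x, σ x = x → ∃ c : K, algebraMap K F c = x)
    (hσ : σ ^ (2 * N) = 1) (hσN : σ ^ N ≠ 1) (hN : finrank K F = 2 * N) (hκ : κ < N)
    {b : Fin (κ + 1) → F} (hb : polar σ N b = 0) (x : F) :
    Algebra.trace (ZMod 2) F (quad σ N b x) = 0 := by
  have : FiniteDimensional K F := Module.Finite.of_finite
  obtain ⟨h0, h1⟩ := (polar_eq_zero_iff hfix hN hκ).1 hb
  rw [quad, Fin.sum_univ_succ]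
  simp only [h1, zero_mul, Finset.sum_const_zero, add_zero, Fin.val_zero, Nat.sub_zero]
  exact trace_mul_norm_eq_zero hσ hσN h0 x

/-- If the values of `a x + Q_b(x)` all have trace zero, then the polar form of `Q_b` is zero. -/
theorem polar_eq_zero_of_traceChar_eq_one (hσ : σ ^ (2 * N) = 1) (hκ : κ ≤ N) {a : F}
    {b : Fin (κ + 1) → F} (h : ∀ x, traceChar F (a * x + quad σ N b x) = 1) :
    polar σ N b = 0 := by
  ext x
  by_contra hx
  refine traceChar_isPrimitive hx (DFunLike.ext _ _ fun y => ?_)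
  have h1 := h (x + y)
  have h2 := h x
  have h3 := h y
  rw [mul_add, AddChar.map_add_eq_mul, AddChar.map_add_eq_mul,
    addChar_quad_add hσ hκ (traceChar_apply_eq σ)] at h1
  rw [AddChar.map_add_eq_mul] at h2 h3
  rw [AddChar.mulShift_apply, AddChar.one_apply, mul_comm]
  linear_combination h1 - traceChar F (y * polar σ N b x) * (h2 * (traceChar F (a * y) *
    traceChar F (quad σ N b y)) + h3)

section Powers

variable {M : ℕ} [NeZero M] {α : Fˣ}

omit [Fintype F] [Algebra (ZMod 2) F] [NeZero M] in
theorem pow_val_natCast (hα : orderOf α = M) (t : ℕ) :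
    (α : F) ^ ((t : ZMod M).val) = (α : F) ^ t := by
  rw [ZMod.val_natCast, ← hα, ← Units.val_pow_eq_pow_val, pow_mod_orderOf, Units.val_pow_eq_pow_val]

omit [Fintype F] [Algebra (ZMod 2) F] in
theorem pow_val_add (hα : orderOf α = M) (i t : ZMod M) :
    (α : F) ^ ((i + t).val) = (α : F) ^ i.val * (α : F) ^ t.val := by
  rw [← pow_add, ← pow_val_natCast hα (i.val + t.val)]
  simp

omit [Fintype F] [Algebra (ZMod 2) F] in
theorem pow_val_natCast_mul (hα : orderOf α = M) (f : ℕ) (i : ZMod M) :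
    (α : F) ^ (((f : ZMod M) * i).val) = ((α : F) ^ i.val) ^ f := by
  rw [← pow_mul, ← pow_val_natCast hα (i.val * f)]
  simp [mul_comm]

omit [Algebra (ZMod 2) F] in
theorem bijective_pow_val (hα : orderOf α = M) (hF : Fintype.card F = M + 1) :
    Function.Bijective fun i : ZMod M => α ^ i.val := by
  classical
  rw [Fintype.bijective_iff_injective_and_card]
  refine ⟨fun i j h => ?_, by rw [ZMod.card, Fintype.card_units, hF]; rfl⟩
  have := pow_inj_mod.1 (h : α ^ i.val = α ^ j.val)
  rw [hα, Nat.mod_eq_of_lt (ZMod.val_lt i), Nat.mod_eq_of_lt (ZMod.val_lt j)] at this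
  exact ZMod.val_injective M this

omit [Algebra (ZMod 2) F] in
theorem exists_pow_val_eq (hα : orderOf α = M) (hF : Fintype.card F = M + 1) {x : F}
    (hx : x ≠ 0) : ∃ i : ZMod M, (α : F) ^ i.val = x := by
  obtain ⟨i, hi⟩ := (bijective_pow_val hα hF).2 (Units.mk0 x hx)
  exact ⟨i, by simpa using congrArg Units.val hi⟩

/-- The redundancy of the parametrization: the codeword of `(a, b)` vanishes iff `a = 0` and the polar
form of `b` is zero. -/
theorem codeword_eq_zero_iff (hfix : ∀ x, σ x = x → ∃ c : K, algebraMap K F c = x)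
    (hσ : σ ^ (2 * N) = 1) (hσN : σ ^ N ≠ 1) (hN : finrank K F = 2 * N) (hκ : κ < N)
    (hα : orderOf α = M) (hF : Fintype.card F = M + 1) (p : F × (Fin (κ + 1) → F)) :
    codeword σ N κ M α p = 0 ↔ p.1 = 0 ∧ polar σ N p.2 = 0 := by
  constructor
  · intro h
    have h1 : ∀ x, traceChar F (p.1 * x + quad σ N p.2 x) = 1 := fun x => by
      by_cases hx : x = 0
      · subst hx
        simp [quad]
      · obtain ⟨i, rfl⟩ := exists_pow_val_eq hα hF hx
        exact traceChar_eq_one_iff.2 (congrFun h i)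
    have h2 := polar_eq_zero_of_traceChar_eq_one hσ hκ.le h1
    refine ⟨?_, h2⟩
    by_contra ha
    refine traceChar_isPrimitive ha (DFunLike.ext _ _ fun x => ?_)
    have h3 := h1 x
    rw [AddChar.map_add_eq_mul, traceChar_eq_one_iff.2
      (trace_quad_eq_zero hfix hσ hσN hN hκ h2 x), mul_one] at h3
    rw [AddChar.mulShift_apply, h3, AddChar.one_apply]
  · rintro ⟨h1, h2⟩
    funext i
    rw [codeword_apply, h1, zero_mul, zero_add]
    exact trace_quad_eq_zero hfix hσ hσN hN hκ h2 _

/-- The DC component of a codeword is its exponential sum without the term at zero. -/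
theorem dc_codeword (hα : orderOf α = M) (hF : Fintype.card F = M + 1)
    (p : F × (Fin (κ + 1) → F)) :
    (BinSeq.dc (codeword σ N κ M α p) : ℚ) = expSum (traceChar F) σ N p.1 p.2 - 1 := by
  classical
  have h1 : (BinSeq.dc (codeword σ N κ M α p) : ℚ)
      = ∑ i : ZMod M, traceChar F (p.1 * (α : F) ^ i.val + quad σ N p.2 ((α : F) ^ i.val)) := by
    rw [BinSeq.dc]
    push_cast
    refine Finset.sum_nbij' (fun i => (i : ZMod M)) ZMod.val (by simp)
      (fun i _ => Finset.mem_range.2 (ZMod.val_lt i))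
      (fun i hi => ZMod.val_cast_of_lt (Finset.mem_range.1 hi)) (by simp) (fun i _ => rfl)
  have h2 : ∑ i : ZMod M, traceChar F (p.1 * (α : F) ^ i.val + quad σ N p.2 ((α : F) ^ i.val))
      = ∑ x : Fˣ, traceChar F (p.1 * (x : F) + quad σ N p.2 (x : F)) :=
    Fintype.sum_bijective _ (bijective_pow_val hα hF) _ _ fun i => by simp
  rw [h1, h2, expSum, ← Finset.add_sum_erase _ _ (Finset.mem_univ (0 : F))]
  have h3 : traceChar F (p.1 * 0 + quad σ N p.2 0) = 1 := by simp [quad]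
  rw [h3, add_sub_cancel_left]
  refine Finset.sum_bij (fun x _ => (x : F)) (by simp) (fun _ _ _ _ h => Units.ext h)
    (fun x hx => ⟨Units.mk0 x (Finset.mem_erase.1 hx).1, Finset.mem_univ _, rfl⟩) fun _ _ => rfl

end Powers

end Code

/-! ### Generation of the code by shifts and decimations -/

section Generation

variable {K F : Type*} [Field K] [Field F] [Fintype F] [Algebra K F] [Algebra (ZMod 2) F]
  {σ : F ≃ₐ[K] F} {N κ : ℕ}

omit [Algebra (ZMod 2) F] in
/-- The elements fixed by the involution `x ↦ x ^ 2 ^ n` are the norms `x ^ (2 ^ n + 1)`. An odd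
multiple `c` of `n` gives the same involution. -/
theorem exists_mul_pow_eq {n c : ℕ} (hc : Odd c) {α : Fˣ}
    (hα : orderOf α = 2 ^ (2 * n) - 1) (hF : Fintype.card F = 2 ^ (2 * n)) {β : F} (hβ : β ≠ 0)
    (h : β ^ 2 ^ (n * c) = β) : ∃ x : F, x ≠ 0 ∧ x * x ^ 2 ^ (n * c) = β := by
  obtain ⟨r, rfl⟩ := hc
  have hred : ∀ x : F, x ^ 2 ^ (n * (2 * r + 1)) = x ^ 2 ^ n := fun x => by
    rw [show n * (2 * r + 1) = 2 * n * r + n by ring, pow_add, pow_mul x, pow_mul 2 (2 * n) r, ← hF,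
      FiniteField.pow_card_pow]
  have hn : 0 < n := by
    rcases Nat.eq_zero_or_pos n with rfl | hn
    · have := Fintype.one_lt_card (α := F)
      rw [hF] at this
      simp at this
    · exact hn
  have h2n := Nat.one_lt_two_pow hn.ne'
  have hfac : 2 ^ (2 * n) - 1 = (2 ^ n + 1) * (2 ^ n - 1) := by
    rw [mul_comm 2 n, pow_mul, ← Nat.sq_sub_sq]
  have hM : 2 ^ (2 * n) - 1 ≠ 0 := by
    rw [hfac]
    exact Nat.mul_ne_zero (by omega) (by omega)
  have : NeZero (2 ^ (2 * n) - 1) := ⟨hM⟩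
  obtain ⟨i, rfl⟩ := exists_pow_val_eq hα (by rw [hF]; omega) hβ
  clear hβ
  rw [hred] at h
  generalize i.val = i at h ⊢
  have h1 : α ^ (i * (2 ^ n - 1)) = 1 := by
    have h2 : α ^ (i * (2 ^ n - 1)) * α ^ i = α ^ i := by
      rw [← pow_add, ← Units.val_inj]
      push_cast
      rw [← h, ← pow_mul]
      congr 1
      have : i * 2 ^ n = i * (2 ^ n - 1) + i := by
        obtain ⟨w, hw⟩ : ∃ w, 2 ^ n = w + 1 := ⟨2 ^ n - 1, by omega⟩
        rw [hw, Nat.add_sub_cancel]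
        ring
      exact this.symm
    exact mul_eq_right.1 h2
  have h2 := orderOf_dvd_of_pow_eq_one h1
  rw [hα, hfac] at h2
  obtain ⟨t, ht⟩ := Nat.dvd_of_mul_dvd_mul_right (by omega) h2
  refine ⟨(α : F) ^ t, pow_ne_zero _ α.ne_zero, ?_⟩
  rw [hred, ht, ← pow_mul, ← pow_add]
  congr 1
  ring

variable {M n d e : ℕ} [NeZero M] {α : Fˣ} {θ : F} {s : BinSeq M}

omit [Fintype F] in
theorem shift_eq_codeword (hα : orderOf α = M)
    (hs : ∀ i : ZMod M, s i = Algebra.trace (ZMod 2) F (θ * (α : F) ^ i.val)) (t : ZMod M) :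
    BinSeq.shift t s = codeword σ N κ M α (θ * (α : F) ^ t.val, 0) := by
  funext i
  rw [codeword_apply, BinSeq.shift, hs, pow_val_add hα]
  simp only [quad, Pi.zero_apply, zero_mul, Finset.sum_const_zero, add_zero]
  congr 1
  ring

omit [Fintype F] in
theorem shift_kasamiDecimation_eq_codeword (hα : orderOf α = M) (hσd : ∀ x, σ x = x ^ 2 ^ d)
    (hs : ∀ i : ZMod M, s i = Algebra.trace (ZMod 2) F (θ * (α : F) ^ i.val)) (t : ZMod M)
    (j : Fin (κ + 1)) :
    BinSeq.shift t (BinSeq.kasamiDecimation n d e s j) = codeword σ (n / e) κ M α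
      (0, Pi.single j (θ * ((α : F) ^ t.val * (σ ^ (n / e - j : ℕ)) ((α : F) ^ t.val)))) := by
  funext i
  rw [codeword_apply, BinSeq.shift, BinSeq.kasamiDecimation, BinSeq.decimate, hs,
    pow_val_natCast_mul hα, pow_val_add hα, quad_single, algEquiv_pow_apply hσd,
    algEquiv_pow_apply hσd]
  congr 1
  rw [pow_succ]
  ring

/-- For `j ≠ 0` the elements `θ x σ^{N-j}(x)` span the field: a functional `Tr(c ·)` vanishing on all of
them would give a quadratic form that is identically zero. -/
theorem span_mul_pow_apply_eq_top (hfix : ∀ x, σ x = x → ∃ c : K, algebraMap K F c = x)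
    (hσ : σ ^ (2 * N) = 1) (hN : finrank K F = 2 * N) (hκ : κ < N) (hα : orderOf α = M)
    (hF : Fintype.card F = M + 1) (hθ : θ ≠ 0) (j : Fin κ) :
    Submodule.span (ZMod 2) (Set.range fun t : ZMod M =>
      θ * ((α : F) ^ t.val * (σ ^ (N - j.succ : ℕ)) ((α : F) ^ t.val))) = ⊤ := by
  have : FiniteDimensional K F := Module.Finite.of_finite
  by_contra hne
  obtain ⟨φ, hφ0, hφ⟩ := Submodule.exists_le_ker_of_lt_top _ (lt_top_iff_ne_top.2 hne)
  obtain ⟨c, hc⟩ := exists_trace_mul_eq φ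
  have h1 : ∀ x, traceChar F (0 * x + quad σ N (Pi.single j.succ (c * θ)) x) = 1 := fun x => by
    by_cases hx : x = 0
    · subst hx
      simp [quad]
    · obtain ⟨t, rfl⟩ := exists_pow_val_eq hα hF hx
      rw [zero_mul, zero_add, quad_single, traceChar_eq_one_iff, mul_assoc, ← hc]
      exact hφ (Submodule.subset_span ⟨t, rfl⟩)
  have h2 := ((polar_eq_zero_iff hfix hN hκ).1
    (polar_eq_zero_of_traceChar_eq_one hσ hκ.le h1)).2 j
  rw [Pi.single_eq_same] at h2
  have h3 : c = 0 := (mul_eq_zero.1 h2).resolve_right hθ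
  refine hφ0 (LinearMap.ext fun x => ?_)
  rw [hc, h3, zero_mul, map_zero, LinearMap.zero_apply]

/-- The code consists of the sequences `i ↦ Tr(a α^i) + Tr(Q_b(α^i))`. -/
theorem range_codeword (hfix : ∀ x, σ x = x → ∃ c : K, algebraMap K F c = x)
    (hσ : σ ^ (2 * (n / e)) = 1) (hσN : σ ^ (n / e) ≠ 1) (hN : finrank K F = 2 * (n / e))
    (hκ : κ < n / e) (hα : orderOf α = M) (hF : Fintype.card F = M + 1)
    (hσd : ∀ x, σ x = x ^ 2 ^ d)
    (hnorm : ∀ β : F, β ≠ 0 → (σ ^ (n / e)) β = β → ∃ x, x ≠ 0 ∧ x * (σ ^ (n / e)) x = β)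
    (hs : ∀ i : ZMod M, s i = Algebra.trace (ZMod 2) F (θ * (α : F) ^ i.val))
    (hs0 : BinSeq.kasamiDecimation n d e s 0 ≠ 0) :
    LinearMap.range (codeword σ (n / e) κ M α) = BinSeq.kasamiCode n d e (κ + 1) s := by
  have h2 : CharP F 2 := charP_of_injective_algebraMap (algebraMap (ZMod 2) F).injective 2
  have hgen := shift_kasamiDecimation_eq_codeword (n := n) (e := e) (κ := κ) hα hσd hs
  apply le_antisymm
  · -- the coefficients for which the codeword belongs to the code form a subspace
    have hθ1 : θ + (σ ^ (n / e)) θ ≠ 0 := fun h => hs0 <| by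
      have h1 : BinSeq.kasamiDecimation n d e s 0
          = BinSeq.shift 0 (BinSeq.kasamiDecimation n d e s (0 : Fin (κ + 1))) := by
        funext i
        simp [BinSeq.shift]
      rw [h1, hgen]
      funext i
      rw [codeword_apply, zero_mul, zero_add, quad_single]
      simp only [ZMod.val_zero, pow_zero, map_one, mul_one]
      exact trace_mul_norm_eq_zero hσ hσN h _
    have hθ : θ ≠ 0 := fun h => hθ1 (by rw [h, map_zero, add_zero])
    have hmemj : ∀ (t : ZMod M) (j : Fin (κ + 1)), codeword σ (n / e) κ M α
        (0, Pi.single j (θ * ((α : F) ^ t.val * (σ ^ (n / e - j : ℕ)) ((α : F) ^ t.val))))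
        ∈ BinSeq.kasamiCode n d e (κ + 1) s := fun t j => by
      rw [← hgen]
      exact Submodule.subset_span ⟨t, Or.inr ⟨j, j.2, rfl⟩⟩
    have hfst : ∀ a : F, codeword σ (n / e) κ M α (a, 0) ∈ BinSeq.kasamiCode n d e (κ + 1) s :=
      fun a => by
      by_cases ha : a = 0
      · rw [ha, Prod.mk_zero_zero, map_zero]
        exact Submodule.zero_mem _
      · obtain ⟨t, ht⟩ := exists_pow_val_eq hα hF (div_ne_zero ha hθ)
        have : a = θ * (α : F) ^ t.val := by
          rw [ht]
          field_simp
        rw [this, ← shift_eq_codeword hα hs]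
        exact Submodule.subset_span ⟨t, Or.inl rfl⟩
    have hsnd : ∀ (j : Fin (κ + 1)) (c : F), codeword σ (n / e) κ M α (0, Pi.single j c)
        ∈ BinSeq.kasamiCode n d e (κ + 1) s := fun j c => by
      refine Fin.cases ?_ (fun j => ?_) j
      · by_cases hc : c + (σ ^ (n / e)) c = 0
        · have : codeword σ (n / e) κ M α (0, Pi.single 0 c) = 0 := by
            funext i
            rw [codeword_apply, zero_mul, zero_add, quad_single]
            exact trace_mul_norm_eq_zero hσ hσN hc _
          rw [this]
          exact Submodule.zero_mem _
        · -- up to a form that vanishes identically, `c` is `θ` times a norm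
          have hinv : ∀ x, (σ ^ (n / e)) ((σ ^ (n / e)) x) = x := fun x => by
            rw [← AlgEquiv.mul_apply, ← pow_add, ← two_mul, hσ, AlgEquiv.one_apply]
          set τ := σ ^ (n / e) with hτ
          have hfixed : τ ((c + τ c) / (θ + τ θ)) = (c + τ c) / (θ + τ θ) := by
            rw [map_div₀, map_add, map_add, hinv, hinv, add_comm (τ c), add_comm (τ θ)]
          obtain ⟨x, hx0, hx⟩ := hnorm _ (div_ne_zero hc hθ1) hfixed
          obtain ⟨t, rfl⟩ := exists_pow_val_eq hα hF hx0
          have hdiff : codeword σ (n / e) κ M α (0, Pi.single 0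
              (c - θ * ((c + τ c) / (θ + τ θ)))) = 0 := by
            funext i
            rw [codeword_apply, zero_mul, zero_add, quad_single]
            refine trace_mul_norm_eq_zero hσ hσN ?_ _
            rw [← hτ, map_sub, map_mul, hfixed, CharTwo.sub_eq_add, CharTwo.sub_eq_add,
              add_add_add_comm, ← add_mul, mul_div_cancel₀ _ hθ1, CharTwo.add_self_eq_zero]
          have hsum : ((0, Pi.single 0 c) : F × (Fin (κ + 1) → F))
              = (0, Pi.single 0 (θ * ((c + τ c) / (θ + τ θ))))
                + (0, Pi.single 0 (c - θ * ((c + τ c) / (θ + τ θ)))) := by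
            rw [Prod.mk_add_mk, ← Pi.single_add, add_sub_cancel, add_zero]
          rw [hsum, map_add, hdiff, add_zero, ← hx]
          exact hmemj t 0
      · let S : Submodule (ZMod 2) F := (BinSeq.kasamiCode n d e (κ + 1) s).comap
          (codeword σ (n / e) κ M α ∘ₗ LinearMap.inr (ZMod 2) F (Fin (κ + 1) → F) ∘ₗ
            LinearMap.single (ZMod 2) (fun _ => F) j.succ)
        have hS : ⊤ ≤ S := by
          rw [← span_mul_pow_apply_eq_top hfix hσ hN hκ hα hF hθ j, Submodule.span_le]
          rintro _ ⟨t, rfl⟩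
          exact hmemj t j.succ
        exact hS (Submodule.mem_top (x := c))
    rintro _ ⟨⟨a, b⟩, rfl⟩
    have hsum : ((a, b) : F × (Fin (κ + 1) → F)) = (a, 0) + ∑ j, (0, Pi.single j (b j)) := by
      ext1
      · rw [Prod.fst_add, Prod.fst_sum, Finset.sum_const_zero, add_zero]
      · rw [Prod.snd_add, Prod.snd_sum, zero_add, Finset.univ_sum_single]
    rw [hsum, map_add, map_sum]
    exact Submodule.add_mem _ (hfst a) (Submodule.sum_mem _ fun j _ => hsnd j _)
  · rw [BinSeq.kasamiCode, Submodule.span_le]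
    rintro _ ⟨t, rfl | ⟨j, hj, rfl⟩⟩
    · exact ⟨_, (shift_eq_codeword hα hs t).symm⟩
    · exact ⟨_, (hgen t ⟨j, hj⟩).symm⟩

end Generation

/-! ### Counting the codewords with DC component `-1` -/

section Count

variable {K F : Type*} [Field K] [Fintype K] [Field F] [Fintype F] [Algebra K F]
  {σ : F ≃ₐ[K] F} {N κ : ℕ}

open scoped Classical in
omit [Fintype K] in
theorem card_filter_ker_eq_top [CharP F 2]
    (hfix : ∀ x, σ x = x → ∃ c : K, algebraMap K F c = x)
    (hN : finrank K F = 2 * N) (hκ : κ < N) :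
    (Finset.univ.filter fun b : Fin (κ + 1) → F => LinearMap.ker (polar σ N b) = ⊤).card
      = Nat.card {x // (σ ^ N) x = x} := by
  have : FiniteDimensional K F := Module.Finite.of_finite
  rw [← Fintype.card_subtype, ← Nat.card_eq_fintype_card]
  have h : ∀ b : Fin (κ + 1) → F, LinearMap.ker (polar σ N b) = ⊤
      ↔ (σ ^ N) (b 0) = b 0 ∧ ∀ j : Fin κ, b j.succ = 0 := fun b => by
    rw [LinearMap.ker_eq_top, polar_eq_zero_iff hfix hN hκ, CharTwo.add_eq_zero,
      eq_comm (a := b 0)]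
  refine Nat.card_congr
    { toFun := fun b => ⟨b.1 0, ((h b.1).1 b.2).1⟩
      invFun := fun x => ⟨Fin.cons x.1 0, (h _).2 ⟨x.2, fun j => rfl⟩⟩
      left_inv := fun b => Subtype.ext <| funext fun j => ?_
      right_inv := fun x => rfl }
  refine Fin.cases rfl (fun j => ?_) j
  exact (((h b.1).1 b.2).2 j).symm

open scoped Classical in
/-- The sum of the reciprocals of the sizes of the radicals over all coefficient vectors. -/
theorem sum_inv_natCard_ker_polar [CharP F 2] {χ : AddChar F ℚ} (hχ : χ.IsPrimitive)
    (hinv : ∀ x, χ (σ x) = χ x)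
    (hfix : ∀ x, σ x = x → ∃ c : K, algebraMap K F c = x) (hσ : σ ^ (2 * N) = 1)
    (hN : finrank K F = 2 * N) (hκ : κ < N) :
    ∑ b : Fin (κ + 1) → F, (Nat.card (LinearMap.ker (polar σ N b)) : ℚ)⁻¹
      = ∑ v ∈ Finset.range (κ + 1), (-1) ^ v * ((Fintype.card K : ℚ) ^ (v * (v + 1)))⁻¹ *
          ((Fintype.card F : ℚ) ^ (κ + 1) * (Fintype.card K : ℚ) ^ v *
              ∏ j ∈ Finset.range v, (1 - (Fintype.card K : ℚ) ^ (2 * j) / Fintype.card F)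
            - Nat.card {x // (σ ^ N) x = x} *
              ∏ j ∈ Finset.range v, ((Fintype.card F : ℚ) - (Fintype.card K : ℚ) ^ (2 * j)))
        + Nat.card {x // (σ ^ N) x = x} / Fintype.card F := by
  have : FiniteDimensional K F := Module.Finite.of_finite
  have hβ : (Fintype.card (Fin (κ + 1) → F) : ℚ) = (Fintype.card F : ℚ) ^ (κ + 1) := by
    rw [Fintype.card_fun, Fintype.card_fin, Nat.cast_pow]
  have h := sum_inv_natCard (K := K) (κ := κ)
    (R := fun b : Fin (κ + 1) → F => LinearMap.ker (polar σ N b)) (fun r hr u hu => by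
      rw [hβ]
      exact card_filter_polar_eq_zero_mul hfix hσ hκ.le hχ hinv hr hu) (fun b hb => by
      have hlt : ¬ 2 * κ < finrank K (LinearMap.ker (polar σ N b)) := fun hlt =>
        hb (LinearMap.ker_eq_top.2 ((polar_eq_zero_iff hfix hN hκ).2
          (coeff_eq_of_lt_finrank_ker hfix hκ.le hlt)))
      obtain ⟨i, hi⟩ := even_finrank_ker_polar hσ hN hκ.le b
      refine ⟨i, by omega, ?_⟩
      rw [Module.natCard_eq_pow_finrank (K := K), hi, Nat.card_eq_fintype_card, two_mul])
  rw [h, card_filter_ker_eq_top hfix hN hκ, hβ]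

open scoped Classical in
omit [Fintype K] in
theorem card_filter_expSum_eq_zero [CharP F 2] {χ : AddChar F ℚ} (hχ : χ.IsPrimitive)
    (hinv : ∀ x, χ (σ x) = χ x) (hσ : σ ^ (2 * N) = 1) (hκ : κ ≤ N) :
    ((Finset.univ.filter fun p : F × (Fin (κ + 1) → F) => expSum χ σ N p.1 p.2 = 0).card : ℚ)
      = (Fintype.card F : ℚ) ^ (κ + 2) - Fintype.card F *
        ∑ b : Fin (κ + 1) → F, (Nat.card (LinearMap.ker (polar σ N b)) : ℚ)⁻¹ := by
  have h1 : ((Finset.univ.filter fun p : F × (Fin (κ + 1) → F) =>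
      expSum χ σ N p.1 p.2 ≠ 0).card : ℚ) = Fintype.card F *
        ∑ b : Fin (κ + 1) → F, (Nat.card (LinearMap.ker (polar σ N b)) : ℚ)⁻¹ := by
    rw [Finset.mul_sum, ← Finset.sum_boole, Fintype.sum_prod_type, Finset.sum_comm]
    refine Finset.sum_congr rfl fun b _ => ?_
    rw [Finset.sum_boole, card_filter_expSum_ne_zero hσ hκ hχ hinv b, div_eq_mul_inv]
  have h2 := Finset.card_filter_add_card_filter_not (s := Finset.univ)
    (fun p : F × (Fin (κ + 1) → F) => expSum χ σ N p.1 p.2 = 0)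
  rw [Finset.card_univ, Fintype.card_prod, Fintype.card_fun, Fintype.card_fin] at h2
  rw [← h1, eq_sub_iff_add_eq]
  have h3 := congrArg (Nat.cast : ℕ → ℚ) h2
  push_cast at h3
  rw [h3]
  ring

open scoped Classical in
omit [Fintype K] in
/-- The pairs `(a, b)` whose exponential sum vanishes are mapped to the codewords with DC component
`-1`, and the fibres are the cosets of the kernel. -/
theorem ncard_mul_natCard_fixed [Algebra (ZMod 2) F] {M : ℕ} [NeZero M] {α : Fˣ}
    (hfix : ∀ x, σ x = x → ∃ c : K, algebraMap K F c = x)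
    (hσ : σ ^ (2 * N) = 1) (hσN : σ ^ N ≠ 1) (hN : finrank K F = 2 * N) (hκ : κ < N)
    (hα : orderOf α = M) (hF : Fintype.card F = M + 1) :
    {c : BinSeq M | c ∈ LinearMap.range (codeword σ N κ M α) ∧ BinSeq.dc c = -1}.ncard
        * Nat.card {x // (σ ^ N) x = x}
      = (Finset.univ.filter fun p : F × (Fin (κ + 1) → F) =>
          expSum (traceChar F) σ N p.1 p.2 = 0).card := by
  have h2 : CharP F 2 := charP_of_injective_algebraMap (algebraMap (ZMod 2) F).injective 2
  have hdc : ∀ p : F × (Fin (κ + 1) → F), BinSeq.dc (codeword σ N κ M α p) = -1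
      ↔ expSum (traceChar F) σ N p.1 p.2 = 0 := fun p => by
    rw [← Int.cast_inj (α := ℚ), dc_codeword hα hF, Int.cast_neg, Int.cast_one]
    constructor <;> intro h <;> linarith
  have hker : (Finset.univ.filter fun p : F × (Fin (κ + 1) → F) =>
      codeword σ N κ M α p = 0).card = Nat.card {x // (σ ^ N) x = x} := by
    rw [← card_filter_ker_eq_top hfix hN hκ]
    refine Finset.card_bij (fun p _ => p.2) ?_ ?_ ?_
    · intro p hp
      rw [Finset.mem_filter, codeword_eq_zero_iff hfix hσ hσN hN hκ hα hF] at hp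
      exact Finset.mem_filter.2 ⟨Finset.mem_univ _, LinearMap.ker_eq_top.2 hp.2.2⟩
    · intro p hp p' hp' h
      rw [Finset.mem_filter, codeword_eq_zero_iff hfix hσ hσN hN hκ hα hF] at hp hp'
      exact Prod.ext (hp.2.1.trans hp'.2.1.symm) h
    · intro b hb
      refine ⟨(0, b), ?_, rfl⟩
      rw [Finset.mem_filter, codeword_eq_zero_iff hfix hσ hσN hN hκ hα hF]
      exact ⟨Finset.mem_univ _, rfl, LinearMap.ker_eq_top.1 (Finset.mem_filter.1 hb).2⟩
  rw [Set.ncard_eq_toFinset_card', ← hker]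
  rw [Finset.card_eq_sum_card_fiberwise (f := codeword σ N κ M α)
    (s := Finset.univ.filter fun p : F × (Fin (κ + 1) → F) =>
      expSum (traceChar F) σ N p.1 p.2 = 0)
    (t := {c : BinSeq M | c ∈ LinearMap.range (codeword σ N κ M α)
      ∧ BinSeq.dc c = -1}.toFinset) fun p hp => by
        rw [Finset.mem_coe, Set.mem_toFinset]
        exact ⟨⟨p, rfl⟩, (hdc p).2 (Finset.mem_filter.1 hp).2⟩]
  refine (Finset.sum_const_nat fun c hc => ?_).symm
  obtain ⟨⟨p, rfl⟩, hc2⟩ := Set.mem_toFinset.1 hc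
  rw [Finset.filter_filter]
  refine Eq.trans ?_ (AddMonoidHom.card_fiber_eq_of_mem_range (codeword σ N κ M α)
    (x := codeword σ N κ M α p) ⟨p, rfl⟩ ⟨0, map_zero _⟩)
  congr 1
  ext p'
  simp only [Finset.mem_filter, Finset.mem_univ, true_and]
  exact ⟨fun h => h.2, fun h => ⟨(hdc p').1 ((congrArg BinSeq.dc h).trans hc2), h⟩⟩

end Count

/-! ### The asymptotic estimate -/

section Estimate

variable {q Q T : ℚ}

theorem prod_one_sub_div_mem_Icc {v : ℕ} (hq : 2 ≤ q) (hQ : 0 < Q) (h : ∀ j < v, q ^ (2 * j) ≤ Q) :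
    (∏ j ∈ Finset.range v, (1 - q ^ (2 * j) / Q)) ∈ Set.Icc (0 : ℚ) 1 ∧
      Q * (1 - ∏ j ∈ Finset.range v, (1 - q ^ (2 * j) / Q)) ≤ q ^ (2 * v) / 3 := by
  induction v with
  | zero => simp
  | succ v ih =>
    obtain ⟨⟨h0, h1⟩, h2⟩ := ih fun j hj => h j (by omega)
    have hv := h v (by omega)
    have hpos : 0 < q ^ (2 * v) := by positivity
    have hy0 : 0 ≤ q ^ (2 * v) / Q := by positivity
    have hy1 : q ^ (2 * v) / Q ≤ 1 := (div_le_one hQ).2 hv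
    have hyQ : Q * (q ^ (2 * v) / Q) = q ^ (2 * v) := by field_simp
    rw [Finset.prod_range_succ]
    set P := ∏ j ∈ Finset.range v, (1 - q ^ (2 * j) / Q)
    set y := q ^ (2 * v) / Q
    refine ⟨⟨mul_nonneg h0 (by linarith), mul_le_one₀ h1 (by linarith) (by linarith)⟩, ?_⟩
    have h3 : q ^ (2 * (v + 1)) = q ^ (2 * v) * q ^ 2 := by ring
    have h4 : 4 * q ^ (2 * v) ≤ q ^ (2 * (v + 1)) := by
      rw [h3]
      nlinarith [mul_nonneg hpos.le (by nlinarith : (0 : ℚ) ≤ q ^ 2 - 4)]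
    have h5 : Q * (1 - P * (1 - y)) = Q * (1 - P) + P * q ^ (2 * v) := by
      rw [← hyQ]
      ring
    have h6 : P * q ^ (2 * v) ≤ q ^ (2 * v) := mul_le_of_le_one_left hpos.le h1
    rw [h5]
    linarith

theorem sum_pow_le (hQ : 4 ≤ Q) (κ : ℕ) :
    ∑ w ∈ Finset.range κ, Q ^ (w + 2) / 4 ≤ Q ^ (κ + 1) / 3 := by
  induction κ with
  | zero => simp; linarith
  | succ κ ih =>
    rw [Finset.sum_range_succ]
    have : 0 ≤ Q ^ (κ + 1) := by positivity
    have h : Q ^ (κ + 2) = Q ^ (κ + 1) * Q := by ring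
    rw [show κ + 1 + 1 = κ + 2 by ring, h] at *
    nlinarith

theorem sum_geometric_half_le (κ : ℕ) : ∑ w ∈ Finset.range κ, ((1 : ℚ) / 2) ^ w ≤ 2 := by
  have h : ∑ w ∈ Finset.range κ, ((1 : ℚ) / 2) ^ w = 2 - 2 * (1 / 2) ^ κ := by
    induction κ with
    | zero => simp
    | succ κ ih => rw [Finset.sum_range_succ, ih]; ring
  have : (0 : ℚ) ≤ (1 / 2) ^ κ := by positivity
  linarith

/-- With `q = 2 ^ e`, `T = 2 ^ n` and `Q = T ^ 2`, the exact count differs from its approximation by at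
most `Q ^ (κ + 1)`. The products `∏ (1 - q^{2j} / Q)` are close to one, and the terms without the large
factor grow geometrically up to the last one. -/
theorem abs_count_sub_approx_le {κ : ℕ} (hq : 2 ≤ q) (hT : 0 < T) (hTQ : T ^ 2 = Q)
    (hqT : 0 < κ → q ^ 2 ≤ T) (h : ∀ j < κ, q ^ (2 * j) ≤ Q) (hQ1 : 1 ≤ Q) :
    |T * Q ^ (κ + 1) - 1 - ∑ v ∈ Finset.range (κ + 1), (-1) ^ v *
        (Q ^ (κ + 1 - v) * q ^ v / T - 1) * (Q / q ^ (v * (v + 1))) *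
          ∏ j ∈ Finset.range v, (Q - q ^ (2 * j))
      - T * Q ^ (κ + 1) * ∑ w ∈ Finset.range κ, (-1) ^ w * (q ^ ((w + 1) ^ 2))⁻¹|
      ≤ Q ^ (κ + 1) := by
  have hQ : 0 < Q := by linarith
  have hq0 : 0 < q := by linarith
  let π : ℕ → ℚ := fun v => ∏ j ∈ Finset.range v, (1 - q ^ (2 * j) / Q)
  have hπ : ∀ v, ∏ j ∈ Finset.range v, (Q - q ^ (2 * j)) = Q ^ v * π v := fun v => by
    have : Q ^ v = ∏ _j ∈ Finset.range v, Q := by simp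
    rw [this, ← Finset.prod_mul_distrib]
    exact Finset.prod_congr rfl fun j _ => by field_simp
  have hterm : ∀ w ∈ Finset.range κ, (-1) ^ (w + 1) *
        (Q ^ (κ + 1 - (w + 1)) * q ^ (w + 1) / T - 1) * (Q / q ^ ((w + 1) * (w + 1 + 1))) *
          ∏ j ∈ Finset.range (w + 1), (Q - q ^ (2 * j))
      = (-1) ^ w * (Q ^ (w + 2) / q ^ ((w + 1) * (w + 2)) * π (w + 1)
        + T * Q ^ κ * (q ^ ((w + 1) ^ 2))⁻¹ * (Q * (1 - π (w + 1))))
        - T * Q ^ (κ + 1) * ((-1) ^ w * (q ^ ((w + 1) ^ 2))⁻¹) := fun w hw => by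
    obtain ⟨u, rfl⟩ : ∃ u, κ = w + 1 + u := ⟨κ - (w + 1), by
      rw [Finset.mem_range] at hw; omega⟩
    rw [hπ, show w + 1 + u + 1 - (w + 1) = u + 1 by omega,
      show (w + 1) * (w + 1 + 1) = (w + 1) ^ 2 + (w + 1) by ring,
      pow_add q, ← hTQ]
    field_simp
    ring
  have hE : T * Q ^ (κ + 1) - 1 - ∑ v ∈ Finset.range (κ + 1), (-1) ^ v *
        (Q ^ (κ + 1 - v) * q ^ v / T - 1) * (Q / q ^ (v * (v + 1))) *
          ∏ j ∈ Finset.range v, (Q - q ^ (2 * j))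
      - T * Q ^ (κ + 1) * ∑ w ∈ Finset.range κ, (-1) ^ w * (q ^ ((w + 1) ^ 2))⁻¹
      = (Q - 1) - ∑ w ∈ Finset.range κ, (-1) ^ w * (Q ^ (w + 2) / q ^ ((w + 1) * (w + 2)) * π (w + 1)
        + T * Q ^ κ * (q ^ ((w + 1) ^ 2))⁻¹ * (Q * (1 - π (w + 1)))) := by
    rw [Finset.sum_range_succ', Finset.sum_congr rfl hterm, Finset.sum_sub_distrib, ← Finset.mul_sum]
    simp only [pow_zero, one_mul, Nat.sub_zero, zero_mul, div_one, mul_one, Finset.range_zero,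
      Finset.prod_empty]
    have : Q ^ (κ + 1) / T * Q = T * Q ^ (κ + 1) := by
      rw [← hTQ]
      field_simp
    rw [sub_mul, this]
    ring
  rw [hE]
  rcases Nat.eq_zero_or_pos κ with rfl | hκ
  · simp only [Finset.range_zero, Finset.sum_empty, sub_zero, zero_add, pow_one]
    rw [abs_of_nonneg (by linarith)]
    linarith
  have hqT := hqT hκ
  have hq2 : 4 ≤ q ^ 2 := by nlinarith
  have hQ4 : 4 ≤ Q := by rw [← hTQ]; nlinarith
  have hw : ∀ w ∈ Finset.range κ,
      |(-1) ^ w * (Q ^ (w + 2) / q ^ ((w + 1) * (w + 2)) * π (w + 1)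
        + T * Q ^ κ * (q ^ ((w + 1) ^ 2))⁻¹ * (Q * (1 - π (w + 1))))|
      ≤ Q ^ (w + 2) / 4 + T * Q ^ κ * q / 3 * (1 / 2) ^ w := fun w hw => by
    rw [Finset.mem_range] at hw
    obtain ⟨⟨h0, h1⟩, h2⟩ := prod_one_sub_div_mem_Icc (v := w + 1) hq hQ fun j hj => h j (by omega)
    change 0 ≤ π (w + 1) at h0
    change π (w + 1) ≤ 1 at h1
    change Q * (1 - π (w + 1)) ≤ _ at h2
    rw [abs_mul, abs_pow, abs_neg, abs_one, one_pow, one_mul, abs_of_nonneg]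
    · apply add_le_add
      · refine (mul_le_of_le_one_right (by positivity) h1).trans ?_
        refine div_le_div_of_nonneg_left (by positivity) (by norm_num) ?_
        refine hq2.trans (pow_le_pow_right₀ (by linarith) ?_)
        nlinarith
      · have h3 : (q ^ ((w + 1) ^ 2))⁻¹ * (Q * (1 - π (w + 1))) ≤ q / 3 * (1 / 2) ^ w := by
          refine (mul_le_mul_of_nonneg_left h2 (by positivity)).trans ?_
          rw [one_div, inv_pow, ← div_eq_inv_mul, ← div_eq_mul_inv, div_div, div_div,
            div_le_div_iff₀ (by positivity) (by positivity)]
          have h4 : (2 : ℚ) ^ w ≤ q ^ (w ^ 2) :=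
            (pow_le_pow_left₀ (by norm_num) hq w).trans
              (pow_le_pow_right₀ (by linarith) (Nat.le_self_pow two_ne_zero w))
          calc q ^ (2 * (w + 1)) * (3 * 2 ^ w) ≤ q ^ (2 * (w + 1)) * (3 * q ^ (w ^ 2)) := by gcongr
            _ = q * (3 * q ^ ((w + 1) ^ 2)) := by ring
        calc T * Q ^ κ * (q ^ ((w + 1) ^ 2))⁻¹ * (Q * (1 - π (w + 1)))
            = T * Q ^ κ * ((q ^ ((w + 1) ^ 2))⁻¹ * (Q * (1 - π (w + 1)))) := by ring
          _ ≤ T * Q ^ κ * (q / 3 * (1 / 2) ^ w) := by gcongr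
          _ = _ := by ring
    · have : 0 ≤ 1 - π (w + 1) := by linarith
      positivity
  have hsum := (Finset.abs_sum_le_sum_abs _ _).trans (Finset.sum_le_sum hw)
  rw [Finset.sum_add_distrib, ← Finset.mul_sum] at hsum
  have hA := sum_pow_le hQ4 κ
  have hB : T * Q ^ κ * q / 3 * ∑ w ∈ Finset.range κ, (1 / 2 : ℚ) ^ w ≤ Q ^ (κ + 1) / 3 := by
    have h3 : 2 * q ≤ T := by nlinarith
    calc T * Q ^ κ * q / 3 * ∑ w ∈ Finset.range κ, (1 / 2 : ℚ) ^ w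
        ≤ T * Q ^ κ * q / 3 * 2 := by
          gcongr
          exact sum_geometric_half_le κ
      _ = T * Q ^ κ / 3 * (2 * q) := by ring
      _ ≤ T * Q ^ κ / 3 * T := by gcongr
      _ = Q ^ (κ + 1) / 3 := by rw [← hTQ]; ring
  have hC : Q ≤ Q ^ (κ + 1) / 3 := by
    have h3 : Q ^ 1 ≤ Q ^ κ := pow_le_pow_right₀ hQ1 hκ
    rw [pow_one] at h3
    rw [pow_succ]
    nlinarith
  calc |(Q - 1) - ∑ w ∈ Finset.range κ, _| ≤ |Q - 1| + _ := abs_sub _ _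
    _ ≤ Q + (Q ^ (κ + 1) / 3 + Q ^ (κ + 1) / 3) := by
      refine add_le_add ?_ (hsum.trans (add_le_add hA hB))
      rw [abs_of_nonneg (by linarith)]
      linarith
    _ ≤ Q ^ (κ + 1) := by linarith

end Estimate

/-! ### The number of codewords -/

section Number

variable {K F : Type*} [Field K] [Fintype K] [Field F] [Fintype F] [Algebra K F]
  [Algebra (ZMod 2) F] {σ : F ≃ₐ[K] F} {N κ : ℕ}

/-- The number of codewords with DC component `-1`, in terms of `q = |K|`, `Q = |F|` and `T ^ 2 = Q`. -/
theorem ncard_codeword_dc_eq {M : ℕ} [NeZero M] {α : Fˣ} {q Q T : ℚ}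
    (hfix : ∀ x, σ x = x → ∃ c : K, algebraMap K F c = x)
    (hσ : σ ^ (2 * N) = 1) (hσN : σ ^ N ≠ 1) (hN : finrank K F = 2 * N) (hκ : κ < N)
    (hα : orderOf α = M) (hF : Fintype.card F = M + 1)
    (hq : (Fintype.card K : ℚ) = q) (hQ : (Fintype.card F : ℚ) = Q)
    (hT : (Nat.card {x // (σ ^ N) x = x} : ℚ) = T) (hTQ : T ^ 2 = Q) :
    ({c : BinSeq M | c ∈ LinearMap.range (codeword σ N κ M α) ∧ BinSeq.dc c = -1}.ncard : ℚ)
      = T * Q ^ (κ + 1) - 1 - ∑ v ∈ Finset.range (κ + 1), (-1) ^ v *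
        (Q ^ (κ + 1 - v) * q ^ v / T - 1) * (Q / q ^ (v * (v + 1))) *
          ∏ j ∈ Finset.range v, (Q - q ^ (2 * j)) := by
  have h2 : CharP F 2 := charP_of_injective_algebraMap (algebraMap (ZMod 2) F).injective 2
  have hQ0 : Q ≠ 0 := hQ ▸ Nat.cast_ne_zero.2 Fintype.card_ne_zero
  have hT0 : T ≠ 0 := fun h => hQ0 (by rw [← hTQ, h]; norm_num)
  have h := congrArg (Nat.cast : ℕ → ℚ)
    (ncard_mul_natCard_fixed hfix hσ hσN hN hκ hα hF)
  rw [card_filter_expSum_eq_zero traceChar_isPrimitive (traceChar_apply_eq σ) hσ hκ.le,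
    sum_inv_natCard_ker_polar traceChar_isPrimitive (traceChar_apply_eq σ) hfix hσ hN hκ,
    Nat.cast_mul, hq, hQ, hT] at h
  have hv : ∀ v ∈ Finset.range (κ + 1), (-1) ^ v * (q ^ (v * (v + 1)))⁻¹ *
      (Q ^ (κ + 1) * q ^ v * ∏ j ∈ Finset.range v, (1 - q ^ (2 * j) / Q)
        - T * ∏ j ∈ Finset.range v, (Q - q ^ (2 * j)))
      = T / Q * ((-1) ^ v * (Q ^ (κ + 1 - v) * q ^ v / T - 1) * (Q / q ^ (v * (v + 1))) *
          ∏ j ∈ Finset.range v, (Q - q ^ (2 * j))) := fun v hv => by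
    have h3 : ∏ j ∈ Finset.range v, (Q - q ^ (2 * j))
        = Q ^ v * ∏ j ∈ Finset.range v, (1 - q ^ (2 * j) / Q) := by
      have : Q ^ v = ∏ _j ∈ Finset.range v, Q := by simp
      rw [this, ← Finset.prod_mul_distrib]
      exact Finset.prod_congr rfl fun j _ => by field_simp
    obtain ⟨u, hu⟩ : ∃ u, κ + 1 = v + u := ⟨κ + 1 - v, by
      rw [Finset.mem_range] at hv; omega⟩
    rw [h3, hu, Nat.add_sub_cancel_left, pow_add]
    field_simp
  rw [Finset.sum_congr rfl hv, ← Finset.mul_sum] at h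
  apply mul_right_cancel₀ hT0
  rw [h, ← hTQ]
  field_simp
  ring

end Number

end KasamiCode

theorem theorem1p3 (m n d e k : ℕ) (hn : 0 < n) (hd : 0 < d) (hm : m = 2 * n)
    (hend : e = Nat.gcd n d) (hemd : e = Nat.gcd m d) (hk1 : 1 ≤ k) (hk : k ≤ n / e)
    (s : BinSeq (2 ^ m - 1)) (hs : BinSeq.IsMaxLength m s)
    (hs0 : BinSeq.kasamiDecimation n d e s 0 ≠ 0) :
    (({c : BinSeq (2 ^ m - 1) |
          c ∈ BinSeq.kasamiCode n d e k s ∧ BinSeq.dc c = -1}.ncard : ℕ) : ℚ) =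
        (2 : ℚ) ^ (n * (2 * k + 1)) - 1 -
          ∑ v ∈ Finset.range k,
            (-1 : ℚ) ^ v *
              ((2 : ℚ) ^ ((n : ℤ) * (2 * (k : ℤ) - 1 - 2 * (v : ℤ)) + (e : ℤ) * (v : ℤ)) - 1) *
              (2 : ℚ) ^ ((m : ℤ) - (e : ℤ) * (v : ℤ) * ((v : ℤ) + 1)) *
              ∏ j ∈ Finset.range v, ((2 : ℚ) ^ m - (4 : ℚ) ^ (e * j)) ∧
    |(({c : BinSeq (2 ^ m - 1) |
          c ∈ BinSeq.kasamiCode n d e k s ∧ BinSeq.dc c = -1}.ncard : ℕ) : ℚ) -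
        (2 : ℚ) ^ (n * (2 * k + 1)) *
          ∑ v ∈ Finset.Ico 1 k, (-1 : ℚ) ^ (v - 1) * (2 : ℚ) ^ (-((e : ℤ) * (v : ℤ) ^ 2))| ≤
      (2 : ℚ) ^ (2 * n * k) := by
  obtain ⟨κ, rfl⟩ : ∃ κ, k = κ + 1 := ⟨k - 1, by omega⟩
  have hm0 : 0 < m := by omega
  have he : 0 < e := hend ▸ Nat.gcd_pos_of_pos_left d hn
  have hne : e * (n / e) = n := Nat.mul_div_cancel' (hend ▸ Nat.gcd_dvd_left n d)
  have hde : e * (d / e) = d := Nat.mul_div_cancel' (hend ▸ Nat.gcd_dvd_right n d)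
  have hmN : m / m.gcd d = 2 * (n / e) := by
    rw [← hemd, hm, Nat.mul_div_assoc 2 (hend ▸ Nat.gcd_dvd_left n d)]
  -- the two gcd conditions together say that `d / e` is odd
  have hodd : Odd (d / e) := by
    have hco := Nat.coprime_div_gcd_div_gcd (m := m) (n := d) (hemd ▸ he)
    rw [hmN, ← hemd] at hco
    exact (Nat.coprime_mul_iff_left.1 hco).1.odd_of_left
  have hpos := Nat.one_lt_two_pow hm0.ne'
  have : NeZero (2 ^ m - 1) := ⟨by omega⟩
  obtain ⟨F, _, _, _, α, θ, hF, hα, hsθ⟩ := KasamiCode.exists_field_of_isMaxLength hm0 hs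
  obtain ⟨K, σ, hσd, hfix, hN, hord, hL⟩ := KasamiCode.exists_fixedField (d := d) hF
  rw [hmN] at hN hord hL
  have hN0 : 0 < n / e := by omega
  have hσ : σ ^ (2 * (n / e)) = 1 := hord ▸ pow_orderOf_eq_one σ
  have hσN : σ ^ (n / e) ≠ 1 := pow_ne_one_of_lt_orderOf hN0.ne' (by omega)
  -- the fixed field of the involution `σ ^ N` has `2 ^ n` elements
  have hT : Nat.card {x // (σ ^ (n / e)) x = x} = 2 ^ n := by
    have := hL (n / e)
    rw [Nat.gcd_mul_left_left, Nat.mul_div_cancel _ hN0, hm, mul_comm 2 n, pow_mul] at this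
    exact Nat.pow_left_injective two_ne_zero this
  have : Fintype K := Fintype.ofFinite K
  have hq : Fintype.card K = 2 ^ e := by
    have := Module.card_eq_pow_finrank (K := K) (V := F)
    rw [hF, hN, hm] at this
    refine (Nat.pow_left_injective (n := 2 * (n / e)) (by omega) ?_).symm
    change (2 ^ e) ^ (2 * (n / e)) = Fintype.card K ^ (2 * (n / e))
    rw [← this, ← pow_mul]
    congr 1
    rw [mul_left_comm, hne]
  have hcode := KasamiCode.range_codeword (κ := κ) hfix hσ hσN hN (by omega) hα
    (by omega : Fintype.card F = 2 ^ m - 1 + 1) hσd (fun β hβ h => by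
      have hexp : n / e * d = n * (d / e) := by
        conv_lhs => rw [← hde]
        conv_rhs => rw [← hne]
        ring
      simp only [KasamiCode.algEquiv_pow_apply hσd, hexp] at h ⊢
      exact KasamiCode.exists_mul_pow_eq hodd (hm ▸ hα) (hm ▸ hF) hβ h)
    (fun i => by
      have := hsθ i.val
      rwa [ZMod.natCast_zmod_val] at this) hs0
  have hcount := KasamiCode.ncard_codeword_dc_eq (κ := κ) (q := 2 ^ e) (Q := 2 ^ m) (T := 2 ^ n)
    hfix hσ hσN hN (by omega) hα (by omega : Fintype.card F = 2 ^ m - 1 + 1)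
    (by rw [hq]; norm_num) (by rw [hF]; norm_num) (by rw [hT]; norm_num)
    (by rw [hm, ← pow_mul, mul_comm])
  rw [hcode] at hcount
  have hlead : (2 : ℚ) ^ n * (2 ^ m) ^ (κ + 1) = 2 ^ (n * (2 * (κ + 1) + 1)) := by
    rw [← pow_mul, ← pow_add, hm]
    congr 1
    ring
  constructor
  · rw [hcount, hlead]
    congr 1
    refine Finset.sum_congr rfl fun v hv => ?_
    obtain ⟨w, rfl⟩ : ∃ w, κ = v + w := ⟨κ - v, by rw [Finset.mem_range] at hv; omega⟩
    have h1 : (2 : ℚ) ^ ((n : ℤ) * (2 * ((v + w + 1 : ℕ) : ℤ) - 1 - 2 * (v : ℤ))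
        + (e : ℤ) * (v : ℤ)) = (2 ^ m) ^ (v + w + 1 - v) * (2 ^ e) ^ v / 2 ^ n := by
      rw [show (n : ℤ) * (2 * ((v + w + 1 : ℕ) : ℤ) - 1 - 2 * (v : ℤ)) + (e : ℤ) * (v : ℤ)
        = ((n * (2 * w + 1) + e * v : ℕ) : ℤ) by push_cast; ring, zpow_natCast,
        show v + w + 1 - v = w + 1 by omega, eq_div_iff (by positivity), ← pow_mul, ← pow_mul,
        ← pow_add, ← pow_add, hm]
      congr 1
      ring
    have h2 : (2 : ℚ) ^ ((m : ℤ) - (e : ℤ) * (v : ℤ) * ((v : ℤ) + 1))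
        = 2 ^ m / (2 ^ e) ^ (v * (v + 1)) := by
      rw [show (e : ℤ) * (v : ℤ) * ((v : ℤ) + 1) = ((e * (v * (v + 1)) : ℕ) : ℤ) by
        push_cast; ring, zpow_sub₀ two_ne_zero, zpow_natCast, zpow_natCast, pow_mul 2 e]
    have h3 : ∀ j, (4 : ℚ) ^ (e * j) = (2 ^ e) ^ (2 * j) := fun j => by
      rw [show (4 : ℚ) = 2 ^ 2 by norm_num, ← pow_mul, ← pow_mul]
      congr 1
      ring
    simp_rw [h1, h2, h3]
  · have hbound := KasamiCode.abs_count_sub_approx_le (κ := κ) (q := 2 ^ e) (Q := 2 ^ m)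
      (T := 2 ^ n) (le_self_pow₀ (by norm_num) he.ne') (by positivity)
      (by rw [hm, ← pow_mul, mul_comm]) (fun hκ => by
        rw [← pow_mul]
        refine pow_le_pow_right₀ (by norm_num) ?_
        rw [← hne]
        exact Nat.mul_le_mul_left e (by omega)) (fun j hj => by
        rw [← pow_mul]
        refine pow_le_pow_right₀ (by norm_num) ?_
        rw [hm, ← hne, mul_left_comm]
        exact Nat.mul_le_mul_left 2 (Nat.mul_le_mul_left e (by omega)))
      (one_le_pow₀ (by norm_num))
    rw [← hcount, hlead] at hbound
    have h1 : ∑ v ∈ Finset.Ico 1 (κ + 1), (-1 : ℚ) ^ (v - 1) * (2 : ℚ) ^ (-((e : ℤ) * (v : ℤ) ^ 2))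
        = ∑ w ∈ Finset.range κ, (-1) ^ w * ((2 ^ e) ^ ((w + 1) ^ 2))⁻¹ := by
      rw [Finset.sum_Ico_eq_sum_range, Nat.add_sub_cancel]
      refine Finset.sum_congr rfl fun w _ => ?_
      rw [Nat.add_sub_cancel_left, show (e : ℤ) * ((1 + w : ℕ) : ℤ) ^ 2
        = ((e * (w + 1) ^ 2 : ℕ) : ℤ) by push_cast; ring, zpow_neg, zpow_natCast, pow_mul]
    rw [h1]
    refine hbound.trans (le_of_eq ?_)
    rw [← pow_mul, hm]
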